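/- **The CCV $\lambda\mu$-calculus.** Let $x$ range over ordinary variables and $k,l$ over continuation variables. Terms $M$ and jumps $J$ are given by $$M ::= x \mid \lambda x.M \mid MM \mid M\lceil x:=M\rceil \mid \mu k.J,\qquad J ::= [k]M \mid J\lceil x:=M\rceil ,$$ where $L\lceil x:=M\rceil$ stands for "let $x=M$ in $L$" and binds $x$ in $L$. Terms and jumps are taken up to $\alpha$-equivalence and up to the congruence generated by $$L\lceil x:=M\lceil y:=N\rceil\rceil = (L\lceil x:=M\rceil)\lceil y:=N\rceil\ \ (y\notin L),\qquad [k](L\lceil x:=M\rceil)=([k]L)\lceil x:=M\rceil .$$ A value $V$ is a variable or an abstraction $\lambda x.M$. The reduction relation is generated, in arbitrary contexts and modulo the above identification, by the following ten rules ($N$ a non-value, $V$ a value, $z$ fresh): $$\begin{aligned} NM&\to (zM)\lceil z:=N\rceil, & VN&\to (Vz)\lceil z:=N\rceil,\\ (\lambda x.M)V&\to M\lceil x:=V\rceil, & M\lceil x:=V\rceil&\to M\{V/x\},\\ M\lceil x:=\mu k.J\rceil&\to \mu k.\,J\{[k]\square\mapsto[k](M\lceil x:=\square\rceil)\}, & [l]\mu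 k.J&\to J\{l/k\},\\ \lambda x.Vx&\to V\ (x\notin V), & x\lceil x:=M\rceil&\to M,\\ \mu k.[k]M&\to M\ (k\notin M), & (\mu k.J)\lceil x:=M\rceil&\to\mu k.(J\lceil x:=M\rceil)\ (k\notin M). \end{aligned}$$ **The target calculus** is the sorted $\lambda$-calculus with terms $T::=\lambda k.Q\mid WW$, jumps $Q::=KW\mid TK$, values $W::=x\mid\lambda x.T$ and continuations $K::=k\mid\lambda x.Q$, with $\beta\eta$-reduction in arbitrary contexts. **The CPS translation** $[\![M]\!]=[\![M]\!]_c$ is defined by the colon translation ($V,V_i$ values, $N,N_i$ non-values, bound variables on the right chosen fresh): $$\begin{aligned} \langle V\rangle[K]&=KV^*, & \langle V_1V_2\rangle[K]&=V_1^*V_2^*K,\\ \langle VN\rangle[K]&=\langle N\rangle[\lambda y.V^*yK], & \langle NV\rangle[K]&=\langle N\rangle[\lambda x.xV^*K],\\ \langle N_1N_2\rangle[K]&=\langle N_1\rangle[\lambda x.\langle N_2\rangle[\lambda y.xyK]], & \langle L\lceil x:=M\rceil\rangle[K]&=\langle M\rangle[\lambda x.\langle L\rangle[K]],\\ \langle\mu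 k.J\rangle[K]&=(\lambda k.\langle J\rangle)K, & \langle[k]M\rangle&=\langle M\rangle[k],\\ \langle J\lceil x:=M\rceil\rangle&=\langle M\rangle[\lambda x.\langle J\rangle], & x^*&=x,\\ (\lambda x.M)^*&=\lambda x.\lambda k.\langle M\rangle[k], & [\![M]\!]_c&=\lambda k.\langle M\rangle[k]. \end{aligned}$$ A term is strongly normalizable if every reduction sequence starting from it is finite. **Theorem.** A CCV $\lambda\mu$-term $M$ is strongly normalizable if and only if $[\![M]\!]_c$ is strongly normalizable with respect to $\beta\eta$-reduction in the sorted target calculus. -/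

import Mathlib

/-- `a` is strongly normalizable for the reduction relation `r`: every reduction sequence
starting from `a` is finite (accessibility for the reverse of `r`). -/
def StronglyNormalizable {α : Type*} (r : α → α → Prop) (a : α) : Prop :=
  Acc (fun y x => r x y) a

namespace CCV

/-- The extension of a renaming of de Bruijn indices under one binder. -/
def lift (ρ : ℕ → ℕ) : ℕ → ℕ
  | 0 => 0
  | n + 1 => ρ n + 1

/-- The sequence `a, f 0, f 1, …`. -/
def scons {α : Type*} (a : α) (f : ℕ → α) : ℕ → α
  | 0 => a
  | n + 1 => f n

/-! ### The sorted target lambda calculus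

Ordinary variables and continuation variables are de Bruijn indices, counted separately. -/

/-- The four sorts of the target calculus. -/
inductive TSort
  | term
  | jump
  | value
  | cont

/-- `T ::= λk. Q | W W`,  `Q ::= K W | T K`,  `W ::= x | λx. T`,  `K ::= k | λx. Q`. -/
inductive Tgt : TSort → Type
  | lamK (Q : Tgt .jump) : Tgt .term
  | app (W₁ W₂ : Tgt .value) : Tgt .term
  | kapp (K : Tgt .cont) (W : Tgt .value) : Tgt .jump
  | tapp (T : Tgt .term) (K : Tgt .cont) : Tgt .jump
  | var (x : ℕ) : Tgt .value
  | lamV (T : Tgt .term) : Tgt .value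
  | kvar (k : ℕ) : Tgt .cont
  | lamC (Q : Tgt .jump) : Tgt .cont

namespace Tgt

/-- Renaming of ordinary variables by `ρ` and of continuation variables by `κ`. -/
def ren : {s : TSort} → Tgt s → (ρ κ : ℕ → ℕ) → Tgt s
  | _, lamK Q, ρ, κ => lamK (Q.ren ρ (lift κ))
  | _, app W₁ W₂, ρ, κ => app (W₁.ren ρ κ) (W₂.ren ρ κ)
  | _, kapp K W, ρ, κ => kapp (K.ren ρ κ) (W.ren ρ κ)
  | _, tapp T K, ρ, κ => tapp (T.ren ρ κ) (K.ren ρ κ)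
  | _, var x, ρ, _ => var (ρ x)
  | _, lamV T, ρ, κ => lamV (T.ren (lift ρ) κ)
  | _, kvar k, _, κ => kvar (κ k)
  | _, lamC Q, ρ, κ => lamC (Q.ren (lift ρ) κ)

/-- Weakening by one fresh ordinary variable. -/
def wkV {s : TSort} (P : Tgt s) : Tgt s := P.ren Nat.succ id

/-- Weakening by one fresh continuation variable. -/
def wkK {s : TSort} (P : Tgt s) : Tgt s := P.ren id Nat.succ

/-- Simultaneous capture-avoiding substitution of values for ordinary variables and of
continuations for continuation variables. -/
def sub : {s : TSort} → Tgt s → (ℕ → Tgt .value) → (ℕ → Tgt .cont) → Tgt s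
  | _, lamK Q, σ, θ => lamK (Q.sub (fun n => (σ n).wkK) (scons (kvar 0) fun n => (θ n).wkK))
  | _, app W₁ W₂, σ, θ => app (W₁.sub σ θ) (W₂.sub σ θ)
  | _, kapp K W, σ, θ => kapp (K.sub σ θ) (W.sub σ θ)
  | _, tapp T K, σ, θ => tapp (T.sub σ θ) (K.sub σ θ)
  | _, var x, σ, _ => σ x
  | _, lamV T, σ, θ => lamV (T.sub (scons (var 0) fun n => (σ n).wkV) fun n => (θ n).wkV)
  | _, kvar k, _, θ => θ k
  | _, lamC Q, σ, θ => lamC (Q.sub (scons (var 0) fun n => (σ n).wkV) fun n => (θ n).wkV)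

/-- `P{W/x}`, where `x` is the ordinary variable with index `0`. -/
def instV {s : TSort} (P : Tgt s) (W : Tgt .value) : Tgt s := P.sub (scons W var) kvar

/-- `P{K/k}`, where `k` is the continuation variable with index `0`. -/
def instK {s : TSort} (P : Tgt s) (K : Tgt .cont) : Tgt s := P.sub var (scons K kvar)

/-- One-step `βη`-reduction, in any context. -/
inductive Step : {s : TSort} → Tgt s → Tgt s → Prop
  | betaV (T : Tgt .term) (W : Tgt .value) : Step (app (lamV T) W) (T.instV W)
  | betaK (Q : Tgt .jump) (K : Tgt .cont) : Step (tapp (lamK Q) K) (Q.instK K)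
  | betaC (Q : Tgt .jump) (W : Tgt .value) : Step (kapp (lamC Q) W) (Q.instV W)
  | etaV (W : Tgt .value) : Step (lamV (app W.wkV (var 0))) W
  | etaK (T : Tgt .term) : Step (lamK (tapp T.wkK (kvar 0))) T
  | etaC (K : Tgt .cont) : Step (lamC (kapp K.wkV (var 0))) K
  | lamK {Q Q' : Tgt .jump} : Step Q Q' → Step (lamK Q) (lamK Q')
  | appL {W₁ W₁' W₂ : Tgt .value} : Step W₁ W₁' → Step (app W₁ W₂) (app W₁' W₂)
  | appR {W₁ W₂ W₂' : Tgt .value} : Step W₂ W₂' → Step (app W₁ W₂) (app W₁ W₂')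
  | kappL {K K' : Tgt .cont} {W : Tgt .value} : Step K K' → Step (kapp K W) (kapp K' W)
  | kappR {K : Tgt .cont} {W W' : Tgt .value} : Step W W' → Step (kapp K W) (kapp K W')
  | tappL {T T' : Tgt .term} {K : Tgt .cont} : Step T T' → Step (tapp T K) (tapp T' K)
  | tappR {T : Tgt .term} {K K' : Tgt .cont} : Step K K' → Step (tapp T K) (tapp T K')
  | lamV {T T' : Tgt .term} : Step T T' → Step (lamV T) (lamV T')
  | lamC {Q Q' : Tgt .jump} : Step Q Q' → Step (lamC Q) (lamC Q')

end Tgt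

/-! ### The CCV `λμ`-calculus -/

/-- Syntactic classes of the source calculus. -/
inductive Srt
  | value
  | term
  | jump

/-- Raw syntax, before the identification by the associativity axioms, with values singled out:
`V ::= x | λx. M`,  `M ::= V | M M | M⌈x := M⌉ | μk. J`,  `J ::= [k] M | J⌈x := M⌉`.
`letT L M` is the let-construct "let `x` = `M` in `L`"; it binds the ordinary variable with
index `0` in its first argument `L`. Likewise `letJ`. -/
inductive Raw : Srt → Type
  | var (x : ℕ) : Raw .value
  | lam (M : Raw .term) : Raw .value
  | val (V : Raw .value) : Raw .term
  | app (M N : Raw .term) : Raw .term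
  | letT (L M : Raw .term) : Raw .term
  | mu (J : Raw .jump) : Raw .term
  | jmp (k : ℕ) (M : Raw .term) : Raw .jump
  | letJ (J : Raw .jump) (M : Raw .term) : Raw .jump

namespace Raw

/-- Renaming of ordinary variables by `ρ` and of continuation variables by `κ`. -/
def ren : {s : Srt} → Raw s → (ρ κ : ℕ → ℕ) → Raw s
  | _, var x, ρ, _ => var (ρ x)
  | _, lam M, ρ, κ => lam (M.ren (lift ρ) κ)
  | _, val V, ρ, κ => val (V.ren ρ κ)
  | _, app M N, ρ, κ => app (M.ren ρ κ) (N.ren ρ κ)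
  | _, letT L M, ρ, κ => letT (L.ren (lift ρ) κ) (M.ren ρ κ)
  | _, mu J, ρ, κ => mu (J.ren ρ (lift κ))
  | _, jmp k M, ρ, κ => jmp (κ k) (M.ren ρ κ)
  | _, letJ J M, ρ, κ => letJ (J.ren (lift ρ) κ) (M.ren ρ κ)

/-- Weakening by one fresh ordinary variable. -/
def wkV {s : Srt} (M : Raw s) : Raw s := M.ren Nat.succ id

/-- Weakening by one fresh ordinary variable inserted just outside the innermost one. -/
def wkV' {s : Srt} (M : Raw s) : Raw s := M.ren (lift Nat.succ) id

/-- Weakening by one fresh continuation variable. -/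
def wkK {s : Srt} (M : Raw s) : Raw s := M.ren id Nat.succ

/-- Simultaneous capture-avoiding substitution of values for ordinary variables. -/
def sub : {s : Srt} → Raw s → (ℕ → Raw .value) → Raw s
  | _, var x, σ => σ x
  | _, lam M, σ => lam (M.sub (scons (var 0) fun n => (σ n).wkV))
  | _, val V, σ => val (V.sub σ)
  | _, app M N, σ => app (M.sub σ) (N.sub σ)
  | _, letT L M, σ => letT (L.sub (scons (var 0) fun n => (σ n).wkV)) (M.sub σ)
  | _, mu J, σ => mu (J.sub fun n => (σ n).wkK)
  | _, jmp k M, σ => jmp k (M.sub σ)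
  | _, letJ J M, σ => letJ (J.sub (scons (var 0) fun n => (σ n).wkV)) (M.sub σ)

/-- `M{V/x}`, where `x` is the ordinary variable with index `0`. -/
def inst {s : Srt} (M : Raw s) (V : Raw .value) : Raw s := M.sub (scons V var)

/-- `J{l/k}`, where `k` is the continuation variable with index `0`. -/
def instK {s : Srt} (J : Raw s) (l : ℕ) : Raw s := J.ren id (scons l id)

/-- The context substitution `P{[k]□ ↦ [k](let x = □ in L)}`: every jump `[k]N` occurring in `P`
becomes `[k](letT L N)`, hereditarily. Here `k` is the index of a continuation variable,
and index `0` in `L` is the bound variable `x`. -/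
def jumpSub : {s : Srt} → Raw s → ℕ → Raw .term → Raw s
  | _, var x, _, _ => var x
  | _, lam M, k, L => lam (M.jumpSub k L.wkV')
  | _, val V, k, L => val (V.jumpSub k L)
  | _, app M N, k, L => app (M.jumpSub k L) (N.jumpSub k L)
  | _, letT P N, k, L => letT (P.jumpSub k L.wkV') (N.jumpSub k L)
  | _, mu J, k, L => mu (J.jumpSub (k + 1) L.wkK)
  | _, jmp j N, k, L =>
      if j = k then jmp j (letT L (N.jumpSub k L)) else jmp j (N.jumpSub k L)
  | _, letJ J N, k, L => letJ (J.jumpSub k L.wkV') (N.jumpSub k L)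

/-- The syntactic equality: the least congruence containing the two associativity axioms. -/
inductive Eqv : {s : Srt} → Raw s → Raw s → Prop
  | assoc (L M N : Raw .term) : Eqv (letT L (letT M N)) (letT (letT L.wkV' M) N)
  | jmpLet (k : ℕ) (L M : Raw .term) : Eqv (jmp k (letT L M)) (letJ (jmp k L) M)
  | refl {s : Srt} (M : Raw s) : Eqv M M
  | symm {s : Srt} {M N : Raw s} : Eqv M N → Eqv N M
  | trans {s : Srt} {L M N : Raw s} : Eqv L M → Eqv M N → Eqv L N
  | lam {M M' : Raw .term} : Eqv M M' → Eqv (lam M) (lam M')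
  | val {V V' : Raw .value} : Eqv V V' → Eqv (val V) (val V')
  | app {M M' N N' : Raw .term} : Eqv M M' → Eqv N N' → Eqv (app M N) (app M' N')
  | letT {M M' N N' : Raw .term} : Eqv M M' → Eqv N N' → Eqv (letT M N) (letT M' N')
  | mu {J J' : Raw .jump} : Eqv J J' → Eqv (mu J) (mu J')
  | jmp {k : ℕ} {M M' : Raw .term} : Eqv M M' → Eqv (jmp k M) (jmp k M')
  | letJ {J J' : Raw .jump} {N N' : Raw .term} : Eqv J J' → Eqv N N' → Eqv (letJ J N) (letJ J' N')

/-- The term is a value. -/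
def IsVal (M : Raw .term) : Prop := ∃ V, M = val V

/-- The ten reduction rules, applied in any context, on raw syntax. -/
inductive Step : {s : Srt} → Raw s → Raw s → Prop
  | ad₁ (N M : Raw .term) : ¬ N.IsVal → Step (app N M) (letT (app (val (var 0)) M.wkV) N)
  | ad₂ (V : Raw .value) (N : Raw .term) : ¬ N.IsVal →
      Step (app (val V) N) (letT (app (val V.wkV) (val (var 0))) N)
  | betaLam (M : Raw .term) (V : Raw .value) : Step (app (val (lam M)) (val V)) (letT M (val V))
  | betaLet (M : Raw .term) (V : Raw .value) : Step (letT M (val V)) (M.inst V)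
  | betaMu (M : Raw .term) (J : Raw .jump) : Step (letT M (mu J)) (mu (J.jumpSub 0 M.wkK))
  | betaJmp (l : ℕ) (J : Raw .jump) : Step (jmp l (mu J)) (J.instK l)
  | etaLam (V : Raw .value) : Step (lam (app (val V.wkV) (val (var 0)))) V
  | etaLet (M : Raw .term) : Step (letT (val (var 0)) M) M
  | etaMu (M : Raw .term) : Step (mu (jmp 0 M.wkK)) M
  | exch (J : Raw .jump) (M : Raw .term) : Step (letT (mu J) M) (mu (letJ J M.wkK))
  | lam {M M' : Raw .term} : Step M M' → Step (lam M) (lam M')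
  | val {V V' : Raw .value} : Step V V' → Step (val V) (val V')
  | appL {M M' N : Raw .term} : Step M M' → Step (app M N) (app M' N)
  | appR {M N N' : Raw .term} : Step N N' → Step (app M N) (app M N')
  | letTL {M M' N : Raw .term} : Step M M' → Step (letT M N) (letT M' N)
  | letTR {M N N' : Raw .term} : Step N N' → Step (letT M N) (letT M N')
  | mu {J J' : Raw .jump} : Step J J' → Step (mu J) (mu J')
  | jmp {k : ℕ} {M M' : Raw .term} : Step M M' → Step (jmp k M) (jmp k M')
  | letJL {J J' : Raw .jump} {N : Raw .term} : Step J J' → Step (letJ J N) (letJ J' N)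
  | letJR {J : Raw .jump} {N N' : Raw .term} : Step N N' → Step (letJ J N) (letJ J N')

/-- The number of constructors. -/
def size : {s : Srt} → Raw s → ℕ
  | _, var _ => 1
  | _, lam M => M.size + 1
  | _, val V => V.size + 1
  | _, app M N => M.size + N.size + 1
  | _, letT L M => L.size + M.size + 1
  | _, mu J => J.size + 1
  | _, jmp _ M => M.size + 1
  | _, letJ J M => J.size + M.size + 1

@[simp] theorem size_ren {s : Srt} (M : Raw s) : ∀ ρ κ : ℕ → ℕ, (M.ren ρ κ).size = M.size := by
  induction M <;> intros <;> simp_all [ren, size]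

@[simp] theorem size_wkV {s : Srt} (M : Raw s) : M.wkV.size = M.size := size_ren ..

@[simp] theorem size_wkK {s : Srt} (M : Raw s) : M.wkK.size = M.size := size_ren ..

mutual

/-- The target value `V*`. -/
def star : Raw .value → Tgt .value
  | var x => .var x
  | lam M => .lamV (.lamK (colon M.wkK (.kvar 0)))
termination_by V => V.size
decreasing_by all_goals (simp [size]; try omega)

/-- The colon translation `⟨M⟩[K]` of a term. The clauses for `app` are tried in order, so that
`N`, `N₁`, `N₂` stand for non-values. -/
def colon : Raw .term → Tgt .cont → Tgt .jump
  | val V, K => .kapp K (star V)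
  | app (val V₁) (val V₂), K => .tapp (.app (star V₁) (star V₂)) K
  | app (val V) N, K => colon N (.lamC (.tapp (.app (star V.wkV) (.var 0)) K.wkV))
  | app N (val V), K => colon N (.lamC (.tapp (.app (.var 0) (star V.wkV)) K.wkV))
  | app N₁ N₂, K =>
      colon N₁ (.lamC (colon N₂.wkV (.lamC (.tapp (.app (.var 1) (.var 0)) K.wkV.wkV))))
  | letT L M, K => colon M (.lamC (colon L K.wkV))
  | mu J, K => .tapp (.lamK (colonJ J)) K
termination_by M => M.size
decreasing_by all_goals (simp [size]; try omega)

/-- The colon translation `⟨J⟩` of a jump. -/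
def colonJ : Raw .jump → Tgt .jump
  | jmp k M => colon M (.kvar k)
  | letJ J M => colon M (.lamC (colonJ J))
termination_by J => J.size
decreasing_by all_goals (simp [size]; try omega)

end

/-- `[[M]] = λk. ⟨M⟩[k]`, with `k` fresh. -/
def cps (M : Raw .term) : Tgt .term := .lamK (colon M.wkK (.kvar 0))

end Raw

/-! The colon translation respects the syntactic equality, hence is defined on its classes. -/

theorem lift_comp (f g : ℕ → ℕ) : lift f ∘ lift g = lift (f ∘ g) := by
  funext n; cases n <;> rfl

theorem Tgt.ren_ren {s : TSort} (P : Tgt s) : ∀ ρ κ ρ' κ' : ℕ → ℕ,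
    (P.ren ρ κ).ren ρ' κ' = P.ren (ρ' ∘ ρ) (κ' ∘ κ) := by
  induction P <;> intros <;> simp_all [Tgt.ren, lift_comp]

theorem Tgt.wkV_ren {s : TSort} (P : Tgt s) (ρ κ : ℕ → ℕ) :
    P.wkV.ren (lift ρ) κ = (P.ren ρ κ).wkV := by
  simp only [Tgt.wkV, Tgt.ren_ren]; rfl

namespace Raw

theorem ren_ren {s : Srt} (M : Raw s) : ∀ ρ κ ρ' κ' : ℕ → ℕ,
    (M.ren ρ κ).ren ρ' κ' = M.ren (ρ' ∘ ρ) (κ' ∘ κ) := by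
  induction M <;> intros <;> simp_all [ren, lift_comp]

theorem wkV_ren {s : Srt} (M : Raw s) (ρ κ : ℕ → ℕ) :
    M.wkV.ren (lift ρ) κ = (M.ren ρ κ).wkV := by
  simp only [wkV, ren_ren]; rfl

theorem wkK_ren {s : Srt} (M : Raw s) (ρ κ : ℕ → ℕ) :
    M.wkK.ren ρ (lift κ) = (M.ren ρ κ).wkK := by
  simp only [wkK, ren_ren]; rfl

theorem ren_val_ne {N : Raw .term} (h : ∀ V, N = val V → False) (ρ κ : ℕ → ℕ) :
    ∀ V, N.ren ρ κ = val V → False := by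
  cases N <;> simp_all [ren]

theorem colon_nn {N₁ N₂ : Raw .term} (h₁ : ∀ V, N₁ = val V → False)
    (h₂ : ∀ V, N₂ = val V → False) (K : Tgt .cont) : colon (app N₁ N₂) K =
      colon N₁ (.lamC (colon N₂.wkV (.lamC (.tapp (.app (.var 1) (.var 0)) K.wkV.wkV)))) := by
  rw [colon]
  exacts [fun V _ h _ => h₁ V h, h₁, h₂]

theorem ren_colon :
    (∀ (V : Raw .value) (ρ κ : ℕ → ℕ), star (V.ren ρ κ) = (star V).ren ρ κ) ∧
    (∀ (M : Raw .term) (K : Tgt .cont) (ρ κ : ℕ → ℕ),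
      colon (M.ren ρ κ) (K.ren ρ κ) = (colon M K).ren ρ κ) ∧
    (∀ (J : Raw .jump) (ρ κ : ℕ → ℕ), colonJ (J.ren ρ κ) = (colonJ J).ren ρ κ) := by
  apply star.mutual_induct
  case case2 => 
    intro M ih ρ κ
    simp only [ren, star, Tgt.ren, ← ih, wkK_ren, lift]
  case case5 =>
    intro V N K hN ihV ihN ρ κ
    have hN' := ren_val_ne hN ρ κ
    have ihV' := ihV (lift ρ) κ
    have ihN' := ihN ρ κ
    simp only [wkV_ren, Tgt.ren, Tgt.wkV_ren, lift] at ihV' ihN'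
    simp only [ren, colon]
    rw [← ihN', ihV']
  case case6 =>
    intro N V K hN ihV ihN ρ κ
    have hN' := ren_val_ne hN ρ κ
    have ihV' := ihV (lift ρ) κ
    have ihN' := ihN ρ κ
    simp only [wkV_ren, Tgt.ren, Tgt.wkV_ren, lift] at ihV' ihN'
    rw [ren, ren, colon, colon, ← ihN', ihV']
    · exact hN
    · exact hN'
  case case7 =>
    intro N₁ N₂ K _ h₁ h₂ ih₂ ih₁ ρ κ
    have h₁' := ren_val_ne h₁ ρ κ
    have h₂' := ren_val_ne h₂ ρ κ
    have ih₂' := ih₂ (lift ρ) κ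
    have ih₁' := ih₁ ρ κ
    simp only [wkV_ren, Tgt.ren, Tgt.wkV_ren, lift] at ih₂' ih₁'
    rw [ren, colon_nn h₁ h₂, colon_nn h₁' h₂', ← ih₁', ← ih₂']
  all_goals intros
  all_goals simp_all [ren, star, colon, colonJ, Tgt.ren, ← Tgt.wkV_ren]

/-- Two expressions that the colon translation does not distinguish. -/
def Inv : (s : Srt) → Raw s → Raw s → Prop
  | .value, V, V' => star V = star V'
  | .term, M, M' => (M.IsVal ↔ M'.IsVal) ∧ ∀ K, colon M K = colon M' K
  | .jump, J, J' => colonJ J = colonJ J'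

theorem isVal_ren (M : Raw .term) (ρ κ : ℕ → ℕ) : (M.ren ρ κ).IsVal ↔ M.IsVal := by
  cases M <;> simp [IsVal, ren]

theorem Inv.app {M M' N N' : Raw .term} (hM : Inv .term M M') (hN : Inv .term N N')
    (hMv : Inv .term M.wkV M'.wkV) (hNv : Inv .term N.wkV N'.wkV) :
    Inv .term (app M N) (app M' N') := by
  refine ⟨by simp [IsVal], fun K => ?_⟩
  obtain ⟨hM, eM⟩ := hM
  obtain ⟨hN, eN⟩ := hN
  by_cases vM : M.IsVal <;> by_cases vN : N.IsVal
  · obtain ⟨V', rfl⟩ := hM.1 vM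
    obtain ⟨V, rfl⟩ := vM
    obtain ⟨W', rfl⟩ := hN.1 vN
    obtain ⟨W, rfl⟩ := vN
    have e₁ := eM (.kvar 0)
    have e₂ := eN (.kvar 0)
    simp_all [colon]
  · have vN' := mt hN.2 vN
    obtain ⟨V', rfl⟩ := hM.1 vM
    obtain ⟨V, rfl⟩ := vM
    have e := hMv.2 K
    simp only [wkV, ren, colon, Tgt.kapp.injEq, true_and] at e
    rw [colon, colon, eN, wkV, wkV, e]
    · exact fun V h => vN' ⟨V, h⟩
    · exact fun V h => vN ⟨V, h⟩
  · have vM' := mt hM.2 vM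
    obtain ⟨V', rfl⟩ := hN.1 vN
    obtain ⟨V, rfl⟩ := vN
    have e := hNv.2 K
    simp only [wkV, ren, colon, Tgt.kapp.injEq, true_and] at e
    rw [colon, colon, eM, wkV, wkV, e]
    · exact fun V h => vM' ⟨V, h⟩
    · exact fun V h => vM ⟨V, h⟩
  · have vM' := mt hM.2 vM
    have vN' := mt hN.2 vN
    rw [colon_nn (fun V h => vM ⟨V, h⟩) (fun V h => vN ⟨V, h⟩),
      colon_nn (fun V h => vM' ⟨V, h⟩) (fun V h => vN' ⟨V, h⟩), eM, hNv.2]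

theorem wkV'_ren {s : Srt} (M : Raw s) (ρ κ : ℕ → ℕ) :
    M.wkV'.ren (lift (lift ρ)) κ = (M.ren (lift ρ) κ).wkV' := by
  simp only [wkV', ren_ren, lift_comp]; rfl

theorem Eqv.inv {s : Srt} {M M' : Raw s} (h : Eqv M M') :
    ∀ ρ κ : ℕ → ℕ, Inv s (M.ren ρ κ) (M'.ren ρ κ) := by
  induction h with
  | assoc L M N =>
    intro ρ κ
    refine ⟨by simp [IsVal, ren], fun K => ?_⟩
    have := ren_colon.2.1 (L.ren (lift ρ) κ) K.wkV (lift Nat.succ) id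
    rw [Tgt.wkV_ren] at this
    simp only [ren, colon, Tgt.wkV, Tgt.ren, wkV'_ren]
    simp only [Tgt.wkV] at this
    rw [← this]; rfl
  | jmpLet k L M => intro ρ κ; simp [Inv, ren, colonJ, colon, Tgt.wkV, Tgt.ren]
  | refl M =>
    rename_i s
    intro ρ κ
    cases s <;> simp [Inv]
  | @symm s _ _ _ ih =>
    intro ρ κ
    have := ih ρ κ
    cases s
    · exact Eq.symm this
    · exact ⟨this.1.symm, fun K => (this.2 K).symm⟩
    · exact Eq.symm this
  | @trans s _ _ _ _ _ ih₁ ih₂ =>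
    intro ρ κ
    have h₁ := ih₁ ρ κ
    have h₂ := ih₂ ρ κ
    cases s
    · exact Eq.trans h₁ h₂
    · exact ⟨h₁.1.trans h₂.1, fun K => (h₁.2 K).trans (h₂.2 K)⟩
    · exact Eq.trans h₁ h₂
  | @lam M M' _ ih =>
    intro ρ κ
    have := (ih (lift ρ) (Nat.succ ∘ κ)).2
    simp only [Inv, ren, star, wkK, ren_ren]
    exact congrArg (fun Q => Tgt.lamV (.lamK Q)) (this _)
  | val _ ih =>
    intro ρ κ
    exact ⟨by simp [IsVal, ren], fun K => by simpa [ren, colon, Inv] using ih ρ κ⟩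
  | app _ _ ihM ihN =>
    intro ρ κ
    refine Inv.app (ihM ρ κ) (ihN ρ κ) ?_ ?_ <;> simp only [wkV, ren_ren]
    exacts [ihM _ _, ihN _ _]
  | letT _ _ ihM ihN =>
    intro ρ κ
    exact ⟨by simp [IsVal, ren], fun K => by simp [ren, colon, (ihM _ _).2, (ihN _ _).2]⟩
  | mu _ ih =>
    intro ρ κ
    have : colonJ _ = colonJ _ := ih ρ (lift κ)
    exact ⟨by simp [IsVal, ren], fun K => by simp [ren, colon, this]⟩
  | jmp _ ih =>
    intro ρ κ
    simp [Inv, ren, colonJ, (ih _ _).2]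
  | letJ _ _ ihJ ihN =>
    intro ρ κ
    have : colonJ _ = colonJ _ := ihJ (lift ρ) κ
    simp [Inv, ren, colonJ, this, (ihN _ _).2]

theorem Eqv.cps_eq {M M' : Raw .term} (h : Eqv M M') : cps M = cps M' :=
  congrArg Tgt.lamK ((h.inv id Nat.succ).2 _)

/-- The syntactic equality as a setoid. -/
instance setoid (s : Srt) : Setoid (Raw s) := ⟨Eqv, ⟨Eqv.refl, Eqv.symm, Eqv.trans⟩⟩

end Raw

/-- Terms of the CCV `λμ`-calculus: raw terms up to the two associativity axioms. -/
def Term : Type := Quotient (Raw.setoid .term)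

namespace Term

/-- One-step reduction of the CCV `λμ`-calculus: a reduction step between some
representatives. -/
def Step (M N : Term) : Prop :=
  ∃ P Q : Raw .term, Quotient.mk _ P = M ∧ Quotient.mk _ Q = N ∧ P.Step Q

/-- The CPS translation `[[M]]` defined by the colon translation. -/
def cps : Term → Tgt .term := Quotient.lift Raw.cps fun _ _ h => Raw.Eqv.cps_eq h

end Term

end CCV

/-!
A term `M` is compared with its translation through an extension `XStep` of `βη`-reduction on the
target calculus.

Three source rules do not become target reductions after translation. For instance, the rule for
`let x = μk. J in L` turns `(λk. Q) (λx. R{K/k})` into `(λk. Q{λx. R/k}) K`: the two have a common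
reduct, but neither reduces to the other. `XStep` adds the three conversions to `βη` as oriented
structural rules. Every source step is then at least one `XStep` on the translation, except for the
two rules that name a non-value operator or operand, which leave the translation unchanged and
decrease the counter `Raw.adCount` (`Raw.Step.red_or_inv`). Hence `M` is strongly normalizable if
its translation is so for `XStep`.

The structural rules cost nothing: strong normalizability for `βη`, for `XStep`, and the inductive
predicate `Tgt.HeadSN` coincide. In a CPS calculus every jump is its own evaluation context, so
`HeadSN` only has to admit a redex at the head as soon as its contractum and its argument are
admitted. That `HeadSN` implies strong normalizability for `XStep` is the main point. It rests on
`Tgt.xsn_tapp_lamK`, for redexes `(λk. Q) K`: a structural rule either replaces `K` by one of its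
tails and keeps the contractum `Q{K/k}`, or exposes a redex whose argument is such a tail, so
induction on `K`, with tails counted as smaller, and then on the contractum applies. For the other
head redexes, every exchange leads back to this case.

Conversely, if `M` is strongly normalizable then its translation satisfies `HeadSN`
(`Raw.good_of_subterm`), by induction on reducts and subterms of `M` modulo the syntactic equality.
By associativity `M` is `N` or `let x = N in L` with `N` not a let, and then the head redex of the
translation is visible in `N`: its contractum is the translation of a reduct of `M`, or of a part of
one.
-/

namespace CCV

/-! ### Substitution in the target calculus -/

theorem lift_id : lift id = id := by funext n; cases n <;> rfl

theorem scons_comp_lift {α : Type*} (a : α) (f : ℕ → α) (ρ : ℕ → ℕ) :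
    (fun n => scons a f (lift ρ n)) = scons a fun n => f (ρ n) := by
  funext n; cases n <;> rfl

namespace Tgt

/-- The extension of a substitution for ordinary variables under a binder of such a variable. -/
def upV (σ : ℕ → Tgt .value) : ℕ → Tgt .value := scons (var 0) fun n => (σ n).wkV

/-- The extension of a substitution for continuation variables under a binder of such a
variable. -/
def upK (θ : ℕ → Tgt .cont) : ℕ → Tgt .cont := scons (kvar 0) fun n => (θ n).wkK

theorem wkK_ren {s : TSort} (P : Tgt s) (ρ κ : ℕ → ℕ) :
    P.wkK.ren ρ (lift κ) = (P.ren ρ κ).wkK := by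
  simp only [wkK, ren_ren]; rfl

theorem wkK_wkV {s : TSort} (P : Tgt s) : P.wkK.wkV = P.wkV.wkK := by
  simp only [wkK, wkV, ren_ren]; rfl

theorem ren_sub {s : TSort} (P : Tgt s) : ∀ (ρ κ : ℕ → ℕ) (σ : ℕ → Tgt .value)
    (θ : ℕ → Tgt .cont), (P.ren ρ κ).sub σ θ = P.sub (fun n => σ (ρ n)) fun n => θ (κ n) := by
  induction P <;> intros <;> simp_all [ren, sub, scons_comp_lift]

theorem upV_ren (σ : ℕ → Tgt .value) (ρ κ : ℕ → ℕ) :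
    (fun n => (upV σ n).ren (lift ρ) κ) = upV fun n => (σ n).ren ρ κ := by
  funext n; cases n
  · rfl
  · exact wkV_ren ..

theorem upK_ren (θ : ℕ → Tgt .cont) (ρ κ : ℕ → ℕ) :
    (fun n => (upK θ n).ren ρ (lift κ)) = upK fun n => (θ n).ren ρ κ := by
  funext n; cases n
  · rfl
  · exact wkK_ren ..

theorem sub_lamK (Q : Tgt .jump) (σ : ℕ → Tgt .value) (θ : ℕ → Tgt .cont) :
    (lamK Q).sub σ θ = lamK (Q.sub (fun n => (σ n).wkK) (upK θ)) := rfl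

theorem sub_lamV (T : Tgt .term) (σ : ℕ → Tgt .value) (θ : ℕ → Tgt .cont) :
    (lamV T).sub σ θ = lamV (T.sub (upV σ) fun n => (θ n).wkV) := rfl

theorem sub_lamC (Q : Tgt .jump) (σ : ℕ → Tgt .value) (θ : ℕ → Tgt .cont) :
    (lamC Q).sub σ θ = lamC (Q.sub (upV σ) fun n => (θ n).wkV) := rfl

theorem sub_ren {s : TSort} (P : Tgt s) : ∀ (σ : ℕ → Tgt .value) (θ : ℕ → Tgt .cont)
    (ρ κ : ℕ → ℕ),
    (P.sub σ θ).ren ρ κ = P.sub (fun n => (σ n).ren ρ κ) fun n => (θ n).ren ρ κ := by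
  induction P with
  | lamK Q ih => intros; simp only [ren, sub_lamK, ih, upK_ren, wkK_ren]
  | lamV T ih => intros; simp only [ren, sub_lamV, ih, upV_ren, wkV_ren]
  | lamC Q ih => intros; simp only [ren, sub_lamC, ih, upV_ren, wkV_ren]
  | _ => intros; simp_all [ren, sub]

theorem wkV_sub {s : TSort} (P : Tgt s) (σ : ℕ → Tgt .value) (θ : ℕ → Tgt .cont) :
    P.wkV.sub σ θ = P.sub (fun n => σ (n + 1)) θ := ren_sub ..

theorem wkK_sub {s : TSort} (P : Tgt s) (σ : ℕ → Tgt .value) (θ : ℕ → Tgt .cont) :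
    P.wkK.sub σ θ = P.sub σ fun n => θ (n + 1) := ren_sub ..

theorem sub_wkV {s : TSort} (P : Tgt s) (σ : ℕ → Tgt .value) (θ : ℕ → Tgt .cont) :
    (P.sub σ θ).wkV = P.sub (fun n => (σ n).wkV) fun n => (θ n).wkV := sub_ren ..

theorem sub_wkK {s : TSort} (P : Tgt s) (σ : ℕ → Tgt .value) (θ : ℕ → Tgt .cont) :
    (P.sub σ θ).wkK = P.sub (fun n => (σ n).wkK) fun n => (θ n).wkK := sub_ren ..

theorem wkV_sub_up {s : TSort} (P : Tgt s) (σ : ℕ → Tgt .value) (θ : ℕ → Tgt .cont) :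
    (P.wkV.sub (upV σ) fun n => (θ n).wkV) = (P.sub σ θ).wkV := by
  rw [wkV_sub, sub_wkV]; rfl

theorem wkK_sub_up {s : TSort} (P : Tgt s) (σ : ℕ → Tgt .value) (θ : ℕ → Tgt .cont) :
    P.wkK.sub (fun n => (σ n).wkK) (upK θ) = (P.sub σ θ).wkK := by
  rw [wkK_sub, sub_wkK]; rfl

theorem upV_sub (σ σ' : ℕ → Tgt .value) (θ' : ℕ → Tgt .cont) :
    (fun n => (upV σ n).sub (upV σ') fun n => (θ' n).wkV) = upV fun n => (σ n).sub σ' θ' := by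
  funext n; cases n
  · rfl
  · simp only [upV, scons, wkV_sub, sub_wkV]

theorem upK_sub (θ θ' : ℕ → Tgt .cont) (σ' : ℕ → Tgt .value) :
    (fun n => (upK θ n).sub (fun n => (σ' n).wkK) (upK θ')) = upK fun n => (θ n).sub σ' θ' := by
  funext n; cases n
  · rfl
  · simp only [upK, scons, wkK_sub, sub_wkK]

theorem sub_sub {s : TSort} (P : Tgt s) : ∀ (σ : ℕ → Tgt .value) (θ : ℕ → Tgt .cont)
    (σ' : ℕ → Tgt .value) (θ' : ℕ → Tgt .cont),
    (P.sub σ θ).sub σ' θ' = P.sub (fun n => (σ n).sub σ' θ') fun n => (θ n).sub σ' θ' := by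
  induction P with
  | lamK Q ih =>
    intros
    simp only [sub_lamK, ih, upK_sub, wkK_sub_up]
  | lamV T ih =>
    intros
    simp only [sub_lamV, ih, upV_sub, wkV_sub_up]
  | lamC Q ih =>
    intros
    simp only [sub_lamC, ih, upV_sub, wkV_sub_up]
  | _ => intros; simp_all [sub]

theorem upV_var : upV var = var := by funext n; cases n <;> rfl

theorem upK_kvar : upK kvar = kvar := by funext n; cases n <;> rfl

theorem sub_id {s : TSort} (P : Tgt s) : P.sub var kvar = P := by
  have h₁ : (fun n => (var n).wkK) = var := rfl
  have h₂ : (fun n => (kvar n).wkV) = kvar := rfl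
  induction P with
  | lamK Q ih => rw [sub_lamK, upK_kvar, h₁, ih]
  | lamV T ih => rw [sub_lamV, upV_var, h₂, ih]
  | lamC Q ih => rw [sub_lamC, upV_var, h₂, ih]
  | _ => simp_all [sub]

theorem ren_eq_sub {s : TSort} (P : Tgt s) (ρ κ : ℕ → ℕ) :
    P.ren ρ κ = P.sub (fun n => var (ρ n)) fun n => kvar (κ n) := by
  conv_lhs => rw [← sub_id (P.ren ρ κ), ren_sub]

theorem instV_sub {s : TSort} (P : Tgt s) (W : Tgt .value) (σ : ℕ → Tgt .value)
    (θ : ℕ → Tgt .cont) :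
    (P.instV W).sub σ θ = (P.sub (upV σ) fun n => (θ n).wkV).instV (W.sub σ θ) := by
  simp only [instV, sub_sub, wkV_sub]
  congr 1
  · funext n; cases n
    · rfl
    · simp [scons, upV, sub, wkV_sub, sub_id]
  · funext n; exact (sub_id _).symm

theorem instK_sub {s : TSort} (P : Tgt s) (K : Tgt .cont) (σ : ℕ → Tgt .value)
    (θ : ℕ → Tgt .cont) :
    (P.instK K).sub σ θ = (P.sub (fun n => (σ n).wkK) (upK θ)).instK (K.sub σ θ) := by
  simp only [instK, sub_sub, wkK_sub]
  congr 1
  · funext n; exact (sub_id _).symm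
  · funext n; cases n
    · rfl
    · simp [scons, upK, sub, wkK_sub, sub_id]

theorem wkV_instV {s : TSort} (P : Tgt s) (W : Tgt .value) : P.wkV.instV W = P := by
  rw [instV, wkV_sub]; exact sub_id P

theorem wkK_instK {s : TSort} (P : Tgt s) (K : Tgt .cont) : P.wkK.instK K = P := by
  rw [instK, wkK_sub]; exact sub_id P

end Tgt
end CCV

namespace CCV
namespace Tgt

open Relation

/-! ### Structural reductions of the target calculus -/

/-- `TailOf K Q`: the continuation `K`, weakened as needed, is reached in the jump `Q` by passing
from the continuation of a jump to the body of that continuation. -/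
inductive TailOf : Tgt .cont → Tgt .jump → Prop
  | kapp (K : Tgt .cont) (W : Tgt .value) : TailOf K (kapp K W)
  | tapp (T : Tgt .term) (K : Tgt .cont) : TailOf K (tapp T K)
  | kappLam {K : Tgt .cont} {Q : Tgt .jump} (W : Tgt .value) :
      TailOf K.wkV Q → TailOf K (Tgt.kapp (lamC Q) W)
  | tappLam {K : Tgt .cont} {Q : Tgt .jump} (T : Tgt .term) :
      TailOf K.wkV Q → TailOf K (Tgt.tapp T (lamC Q))

/-- `Exch P P' K`: the jump `P` contains in tail position a redex `(λk. Q) K`, and `P'` results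
from `P` on replacing it by `Q`, with `k` left free as the continuation variable `0`. -/
inductive Exch : Tgt .jump → Tgt .jump → Tgt .cont → Prop
  | here (Q : Tgt .jump) (K : Tgt .cont) : Exch (tapp (Tgt.lamK Q) K) Q K
  | kapp {P P' : Tgt .jump} {K : Tgt .cont} (W : Tgt .value) :
      Exch P P' K.wkV → Exch (kapp (lamC P) W) (Tgt.kapp (lamC P') W.wkK) K
  | tapp {P P' : Tgt .jump} {K : Tgt .cont} (T : Tgt .term) :
      Exch P P' K.wkV → Exch (Tgt.tapp T (lamC P)) (Tgt.tapp T.wkK (lamC P')) K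

/-- `Q{K/k}` for a continuation `K` that may itself contain the variable `k` of index `0`. -/
def replK {s : TSort} (Q : Tgt s) (K : Tgt .cont) : Tgt s :=
  Q.sub var (scons K fun n => kvar (n + 1))

/-- `βη`-reduction together with three structural rules, whose two sides have a common
`βη`-reduct. They are what the source rules for `(λx. M) V`, for a `μ`-abstraction as the argument
of a let, and for a `μ`-abstraction as the body of a let amount to after translation:
* `betaApp`: `(λx. λk. R) W K ⟶ (λx. R{K/k}) W`,
* `betaMu`: `(λk. Q) (λx. R{K/k}) ⟶ (λk. Q{λx. R/k}) K`, if `k` is in tail position in `R`,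
* `exchC`, `exchT`: `R[(λk. Q) K] ⟶ (λk. R[Q]) K` for a nonempty tail context `R`. -/
inductive XStep : {s : TSort} → Tgt s → Tgt s → Prop
  | betaV (T : Tgt .term) (W : Tgt .value) : XStep (app (lamV T) W) (T.instV W)
  | betaK (Q : Tgt .jump) (K : Tgt .cont) : XStep (tapp (lamK Q) K) (Q.instK K)
  | betaC (Q : Tgt .jump) (W : Tgt .value) : XStep (kapp (lamC Q) W) (Q.instV W)
  | etaV (W : Tgt .value) : XStep (lamV (app W.wkV (var 0))) W
  | etaK (T : Tgt .term) : XStep (lamK (tapp T.wkK (kvar 0))) T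
  | etaC (K : Tgt .cont) : XStep (lamC (kapp K.wkV (var 0))) K
  | betaApp (R : Tgt .jump) (W : Tgt .value) (K : Tgt .cont) :
      XStep (tapp (app (lamV (lamK R)) W) K) (kapp (lamC (R.instK K.wkV)) W)
  | betaMu (Q R : Tgt .jump) (K : Tgt .cont) : TailOf (kvar 0) R →
      XStep (tapp (lamK Q) (lamC (R.instK K.wkV))) (tapp (lamK (Q.replK (lamC R))) K)
  | exchC {P P' : Tgt .jump} {K : Tgt .cont} (W : Tgt .value) : Exch P P' K.wkV →
      XStep (kapp (lamC P) W) (tapp (lamK (kapp (lamC P') W.wkK)) K)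
  | exchT {P P' : Tgt .jump} {K : Tgt .cont} (T : Tgt .term) : Exch P P' K.wkV →
      XStep (tapp T (lamC P)) (tapp (lamK (tapp T.wkK (lamC P'))) K)
  | lamK {Q Q' : Tgt .jump} : XStep Q Q' → XStep (lamK Q) (lamK Q')
  | appL {W₁ W₁' W₂ : Tgt .value} : XStep W₁ W₁' → XStep (app W₁ W₂) (app W₁' W₂)
  | appR {W₁ W₂ W₂' : Tgt .value} : XStep W₂ W₂' → XStep (app W₁ W₂) (app W₁ W₂')
  | kappL {K K' : Tgt .cont} {W : Tgt .value} : XStep K K' → XStep (kapp K W) (kapp K' W)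
  | kappR {K : Tgt .cont} {W W' : Tgt .value} : XStep W W' → XStep (kapp K W) (kapp K W')
  | tappL {T T' : Tgt .term} {K : Tgt .cont} : XStep T T' → XStep (tapp T K) (tapp T' K)
  | tappR {T : Tgt .term} {K K' : Tgt .cont} : XStep K K' → XStep (tapp T K) (tapp T K')
  | lamV {T T' : Tgt .term} : XStep T T' → XStep (lamV T) (lamV T')
  | lamC {Q Q' : Tgt .jump} : XStep Q Q' → XStep (lamC Q) (lamC Q')

theorem Step.xstep {s : TSort} {P P' : Tgt s} (h : Step P P') : XStep P P' := by
  induction h <;> constructor <;> assumption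

theorem upV_wkK (σ : ℕ → Tgt .value) : (fun n => (upV σ n).wkK) = upV fun n => (σ n).wkK := by
  funext n; cases n
  · rfl
  · exact (wkK_wkV _).symm

theorem upK_wkV (θ : ℕ → Tgt .cont) : (fun n => (upK θ n).wkV) = upK fun n => (θ n).wkV := by
  funext n; cases n
  · rfl
  · exact wkK_wkV _

theorem TailOf.sub {K : Tgt .cont} {Q : Tgt .jump} (h : TailOf K Q) : ∀ (σ : ℕ → Tgt .value)
    (θ : ℕ → Tgt .cont), TailOf (K.sub σ θ) (Q.sub σ θ) := by
  induction h with
  | kapp K W => intros; exact .kapp _ _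
  | tapp T K => intros; exact .tapp _ _
  | kappLam W _ ih =>
    intro σ θ
    exact .kappLam _ (by rw [← wkV_sub_up]; exact ih _ _)
  | tappLam W _ ih =>
    intro σ θ
    exact .tappLam _ (by rw [← wkV_sub_up]; exact ih _ _)

theorem Exch.sub {P P' : Tgt .jump} {K : Tgt .cont} (h : Exch P P' K) :
    ∀ (σ : ℕ → Tgt .value) (θ : ℕ → Tgt .cont),
      Exch (P.sub σ θ) (P'.sub (fun n => (σ n).wkK) (upK θ)) (K.sub σ θ) := by
  induction h with
  | here Q K => intros; exact .here _ _
  | kapp W _ ih =>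
    intro σ θ
    have := ih (upV σ) (fun n => (θ n).wkV)
    rw [wkV_sub_up, upV_wkK, ← upK_wkV] at this
    have h := Exch.kapp (W.sub σ θ) this
    rwa [← wkK_sub_up] at h
  | tapp T _ ih =>
    intro σ θ
    have := ih (upV σ) (fun n => (θ n).wkV)
    rw [wkV_sub_up, upV_wkK, ← upK_wkV] at this
    have h := Exch.tapp (T.sub σ θ) this
    rwa [← wkK_sub_up] at h

theorem lamC_instK (Q : Tgt .jump) (K : Tgt .cont) :
    (lamC Q).instK K = lamC (Q.instK K.wkV) := by
  rw [instK, sub_lamC, upV_var]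
  congr 2
  funext n; cases n <;> rfl

/-- The redex that an exchange moves outwards can also be contracted in place. -/
theorem Exch.xstep {P P' : Tgt .jump} {K : Tgt .cont} (h : Exch P P' K) :
    XStep P (P'.instK K) := by
  induction h with
  | here Q K => exact .betaK _ _
  | @kapp P P' K W _ ih =>
    change XStep _ (Tgt.kapp ((Tgt.lamC P').instK K) (W.wkK.instK K))
    rw [lamC_instK, wkK_instK]
    exact .kappL (.lamC ih)
  | @tapp P P' K W _ ih =>
    change XStep _ (Tgt.tapp (W.wkK.instK K) ((Tgt.lamC P').instK K))
    rw [lamC_instK, wkK_instK]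
    exact .tappR (.lamC ih)

theorem Exch.tailOf {P P' : Tgt .jump} {K : Tgt .cont} (h : Exch P P' K) : TailOf K P := by
  induction h with
  | here Q K => exact .tapp _ _
  | kapp W _ ih => exact .kappLam _ ih
  | tapp T _ ih => exact .tappLam _ ih

theorem replK_sub {s : TSort} (Q : Tgt s) (K : Tgt .cont) (σ : ℕ → Tgt .value)
    (θ : ℕ → Tgt .cont) : (Q.replK K).sub (fun n => (σ n).wkK) (upK θ) =
      (Q.sub (fun n => (σ n).wkK) (upK θ)).replK (K.sub (fun n => (σ n).wkK) (upK θ)) := by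
  simp only [replK, sub_sub]
  congr 1
  · funext n; simp only [wkK_sub, sub]; rw [wkK, ren_eq_sub]; rfl
  · funext n; cases n
    · rfl
    · simp only [scons, upK, wkK_sub, sub]; rw [wkK, ren_eq_sub]; rfl

theorem XStep.sub {s : TSort} {P P' : Tgt s} (h : XStep P P') : ∀ (σ : ℕ → Tgt .value)
    (θ : ℕ → Tgt .cont), XStep (P.sub σ θ) (P'.sub σ θ) := by
  induction h with
  | betaV T W => intros; rw [instV_sub]; exact .betaV _ _
  | betaK Q K => intros; rw [instK_sub]; exact .betaK _ _
  | betaC Q W => intros; rw [instV_sub]; exact .betaC _ _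
  | etaV W =>
    intro σ θ
    have := XStep.etaV (W.sub σ θ)
    rwa [← wkV_sub_up] at this
  | etaK T =>
    intro σ θ
    have := XStep.etaK (T.sub σ θ)
    rwa [← wkK_sub_up] at this
  | etaC K =>
    intro σ θ
    have := XStep.etaC (K.sub σ θ)
    rwa [← wkV_sub_up] at this
  | betaApp R W K =>
    intro σ θ
    have := XStep.betaApp (R.sub (fun n => (upV σ n).wkK) (upK fun n => (θ n).wkV))
      (W.sub σ θ) (K.sub σ θ)
    rw [← wkV_sub_up, ← instK_sub] at this
    exact this
  | betaMu Q R K h =>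
    intro σ θ
    have := XStep.betaMu (Q.sub (fun n => (σ n).wkK) (upK θ))
      (R.sub (fun n => (upV σ n).wkK) (upK fun n => (θ n).wkV)) (K.sub σ θ)
      (h.sub (fun n => (upV σ n).wkK) (upK fun n => (θ n).wkV))
    have e := replK_sub Q (Tgt.lamC R) σ θ
    rw [sub_lamC, ← upV_wkK, upK_wkV] at e
    rw [← wkV_sub_up, ← instK_sub, ← e] at this
    exact this
  | exchC W h =>
    intro σ θ
    have := h.sub (upV σ) (fun n => (θ n).wkV)
    rw [wkV_sub_up, upV_wkK, ← upK_wkV] at this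
    have h := XStep.exchC (W.sub σ θ) this
    rwa [← wkK_sub_up] at h
  | exchT T h =>
    intro σ θ
    have := h.sub (upV σ) (fun n => (θ n).wkV)
    rw [wkV_sub_up, upV_wkK, ← upK_wkV] at this
    have h := XStep.exchT (T.sub σ θ) this
    rwa [← wkK_sub_up] at h
  | lamK _ ih => intros; exact .lamK (ih _ _)
  | appL _ ih => intros; exact .appL (ih _ _)
  | appR _ ih => intros; exact .appR (ih _ _)
  | kappL _ ih => intros; exact .kappL (ih _ _)
  | kappR _ ih => intros; exact .kappR (ih _ _)
  | tappL _ ih => intros; exact .tappL (ih _ _)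
  | tappR _ ih => intros; exact .tappR (ih _ _)
  | lamV _ ih => intros; exact .lamV (ih _ _)
  | lamC _ ih => intros; exact .lamC (ih _ _)

theorem XStep.ren {s : TSort} {P P' : Tgt s} (h : XStep P P') (ρ κ : ℕ → ℕ) :
    XStep (P.ren ρ κ) (P'.ren ρ κ) := by
  simp only [ren_eq_sub]; exact h.sub _ _

theorem TailOf.ren {K : Tgt .cont} {Q : Tgt .jump} (h : TailOf K Q) (ρ κ : ℕ → ℕ) :
    TailOf (K.ren ρ κ) (Q.ren ρ κ) := by
  simp only [ren_eq_sub]; exact h.sub _ _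

/-- Many-step reduction of the substituted values and continuations. -/
theorem xsteps_sub {s : TSort} (P : Tgt s) : ∀ {σ σ' : ℕ → Tgt .value} {θ θ' : ℕ → Tgt .cont},
    (∀ n, ReflTransGen XStep (σ n) (σ' n)) → (∀ n, ReflTransGen XStep (θ n) (θ' n)) →
      ReflTransGen XStep (P.sub σ θ) (P.sub σ' θ') := by
  have wV : ∀ {s : TSort} {P P' : Tgt s}, ReflTransGen XStep P P' →
      ReflTransGen XStep P.wkV P'.wkV := fun h => h.lift _ fun _ _ h => h.ren _ _
  have wK : ∀ {s : TSort} {P P' : Tgt s}, ReflTransGen XStep P P' →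
      ReflTransGen XStep P.wkK P'.wkK := fun h => h.lift _ fun _ _ h => h.ren _ _
  have uV : ∀ {σ σ' : ℕ → Tgt .value}, (∀ n, ReflTransGen XStep (σ n) (σ' n)) →
      ∀ n, ReflTransGen XStep (upV σ n) (upV σ' n) := fun h n => by
    cases n
    · exact .refl
    · exact wV (h _)
  have uK : ∀ {θ θ' : ℕ → Tgt .cont}, (∀ n, ReflTransGen XStep (θ n) (θ' n)) →
      ∀ n, ReflTransGen XStep (upK θ n) (upK θ' n) := fun h n => by
    cases n
    · exact .refl
    · exact wK (h _)
  induction P with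
  | var x => intro σ σ' θ θ' hσ _; exact hσ x
  | kvar k => intro σ σ' θ θ' _ hθ; exact hθ k
  | lamK Q ih =>
    intro σ σ' θ θ' hσ hθ
    exact (ih (fun n => wK (hσ n)) (uK hθ)).lift _ fun _ _ h => .lamK h
  | lamV T ih =>
    intro σ σ' θ θ' hσ hθ
    exact (ih (uV hσ) fun n => wV (hθ n)).lift _ fun _ _ h => .lamV h
  | lamC Q ih =>
    intro σ σ' θ θ' hσ hθ
    exact (ih (uV hσ) fun n => wV (hθ n)).lift _ fun _ _ h => .lamC h
  | app W₁ W₂ ih₁ ih₂ =>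
    intro σ σ' θ θ' hσ hθ
    exact ((ih₁ hσ hθ).lift (fun W => app W _) fun _ _ h => .appL h).trans
      ((ih₂ hσ hθ).lift (app _) fun _ _ h => .appR h)
  | kapp K W ih₁ ih₂ =>
    intro σ σ' θ θ' hσ hθ
    exact ((ih₁ hσ hθ).lift (fun K => kapp K _) fun _ _ h => .kappL h).trans
      ((ih₂ hσ hθ).lift (kapp _) fun _ _ h => .kappR h)
  | tapp T K ih₁ ih₂ =>
    intro σ σ' θ θ' hσ hθ
    exact ((ih₁ hσ hθ).lift (fun T => tapp T _) fun _ _ h => .tappL h).trans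
      ((ih₂ hσ hθ).lift (tapp _) fun _ _ h => .tappR h)

theorem xsteps_instV {s : TSort} (P : Tgt s) {W W' : Tgt .value} (h : XStep W W') :
    ReflTransGen XStep (P.instV W) (P.instV W') :=
  xsteps_sub P (fun n => by cases n; exacts [.single h, .refl]) fun _ => .refl

theorem xsteps_instK {s : TSort} (P : Tgt s) {K K' : Tgt .cont} (h : XStep K K') :
    ReflTransGen XStep (P.instK K) (P.instK K') :=
  xsteps_sub P (fun _ => .refl) fun n => by cases n; exacts [.single h, .refl]

end Tgt
end CCV

namespace CCV
namespace Tgt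

open Relation

/-! ### Strong normalization in the target calculus -/

/-- The number of constructors. -/
def size : {s : TSort} → Tgt s → ℕ
  | _, lamK Q => Q.size + 1
  | _, app W₁ W₂ => W₁.size + W₂.size + 1
  | _, kapp K W => K.size + W.size + 1
  | _, tapp T K => T.size + K.size + 1
  | _, var _ => 1
  | _, lamV T => T.size + 1
  | _, kvar _ => 1
  | _, lamC Q => Q.size + 1

theorem size_ren {s : TSort} (P : Tgt s) : ∀ ρ κ : ℕ → ℕ, (P.ren ρ κ).size = P.size := by
  induction P <;> intros <;> simp_all [ren, size]

/-- Strong normalizability for `βη`-reduction extended by the structural rules. -/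
abbrev XSN {s : TSort} (P : Tgt s) : Prop := StronglyNormalizable XStep P

theorem XSN.intro {s : TSort} {P : Tgt s} (h : ∀ P', XStep P P' → XSN P') : XSN P := Acc.intro _ h

theorem XSN.step {s : TSort} {P P' : Tgt s} (h : XSN P) (hP : XStep P P') : XSN P' := h.inv hP

theorem XSN.steps {s : TSort} {P P' : Tgt s} (h : XSN P) (hP : ReflTransGen XStep P P') :
    XSN P' := by
  induction hP with
  | refl => exact h
  | tail _ h' ih => exact ih.step h'

/-- Strong normalizability is inherited along a map that preserves steps. -/
theorem XSN.of_map {s t : TSort} (f : Tgt s → Tgt t)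
    (hf : ∀ {P P'}, XStep P P' → XStep (f P) (f P')) {P : Tgt s} (h : XSN (f P)) : XSN P := by
  generalize e : f P = R at h
  induction h generalizing P with
  | intro R _ ih => subst e; exact .intro fun P' hP => ih _ (hf hP) rfl

theorem XSN.of_wkV {s : TSort} {P : Tgt s} (h : XSN P.wkV) : XSN P :=
  .of_map wkV (fun h => h.ren _ _) h

theorem XSN.of_instV {s : TSort} {P : Tgt s} {W : Tgt .value} (h : XSN (P.instV W)) : XSN P :=
  .of_map (fun P => P.instV W) (fun h => h.sub _ _) h

theorem TailOf.lift_step {K : Tgt .cont} {Q : Tgt .jump} (h : TailOf K Q) :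
    ∀ {K'}, XStep K K' → ∃ Q', XStep Q Q' ∧ TailOf K' Q' := by
  induction h with
  | kapp K W => exact fun h => ⟨_, .kappL h, .kapp _ _⟩
  | tapp T K => exact fun h => ⟨_, .tappR h, .tapp _ _⟩
  | kappLam W _ ih =>
    intro K' h
    obtain ⟨Q', h₁, h₂⟩ := ih (h.ren _ _)
    exact ⟨_, .kappL (.lamC h₁), .kappLam _ h₂⟩
  | tappLam T _ ih =>
    intro K' h
    obtain ⟨Q', h₁, h₂⟩ := ih (h.ren _ _)
    exact ⟨_, .tappR (.lamC h₁), .tappLam _ h₂⟩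

theorem TailOf.xsn {K : Tgt .cont} {Q : Tgt .jump} (h : TailOf K Q) (hQ : XSN Q) : XSN K := by
  induction hQ generalizing K with
  | intro Q _ ih =>
    refine .intro fun K' hK => ?_
    obtain ⟨Q', h₁, h₂⟩ := h.lift_step hK
    exact ih _ h₁ h₂

theorem TailOf.size_lt {K : Tgt .cont} {Q : Tgt .jump} (h : TailOf K Q) : K.size < Q.size := by
  induction h <;> simp_all only [size, wkV, size_ren] <;> omega

theorem wkV_wkV {s : TSort} (P : Tgt s) : P.wkV.ren (lift Nat.succ) id = P.wkV.wkV :=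
  wkV_ren P _ _

theorem TailOf.trans {L : Tgt .cont} {Q : Tgt .jump} (h : TailOf L Q) :
    ∀ {K : Tgt .cont} {P : Tgt .jump}, L = lamC P → TailOf K.wkV P → TailOf K Q := by
  induction h with
  | kapp L W => rintro K P rfl h; exact .kappLam _ h
  | tapp T L => rintro K P rfl h; exact .tappLam _ h
  | kappLam W _ ih =>
    rintro K P rfl h
    exact .kappLam _ (ih rfl (wkV_wkV K ▸ h.ren _ _))
  | tappLam T _ ih =>
    rintro K P rfl h
    exact .tappLam _ (ih rfl (wkV_wkV K ▸ h.ren _ _))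

/-- `K'` is reached from the abstraction `K` by passing to bodies and their continuations. -/
def ContTail (K' K : Tgt .cont) : Prop := ∃ Q, K = lamC Q ∧ TailOf K'.wkV Q

/-- The order on continuations along which strong normalizability of a redex `(λk. Q) K` is
established: reducts and tails are smaller. -/
def ContLt (K' K : Tgt .cont) : Prop := XStep K K' ∨ ContTail K' K

theorem acc_contLt {K : Tgt .cont} (h : XSN K) : Acc ContLt K := by
  suffices H : ∀ K', K' = K ∨ ContTail K' K → Acc ContLt K' from H K (.inl rfl)
  induction h with
  | intro K _ ih =>
    intro K'
    induction hn : K'.size using Nat.strong_induction_on generalizing K' with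
    | _ n ihn =>
      intro hK'
      refine Acc.intro _ fun Y hY => ?_
      rcases hY with hY | ⟨P, rfl, hP⟩
      · rcases hK' with rfl | ⟨Q, rfl, hQ⟩
        · exact ih _ hY _ (.inl rfl)
        · obtain ⟨Q', h₁, h₂⟩ := hQ.lift_step (hY.ren _ _)
          exact ih _ (.lamC h₁) _ (.inr ⟨Q', rfl, h₂⟩)
      · have hs := hP.size_lt
        simp only [wkV, size_ren] at hs
        refine ihn Y.size (by simp only [size] at hn; omega) Y rfl (.inr ?_)
        rcases hK' with rfl | ⟨Q, rfl, hQ⟩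
        · exact ⟨P, rfl, hP⟩
        · exact ⟨Q, rfl, hQ.trans rfl (wkV_wkV Y ▸ hP.ren _ _)⟩

theorem TailOf.instK {R : Tgt .jump} (h : TailOf (kvar 0) R) (K : Tgt .cont) :
    TailOf K (R.instK K) := h.sub var (scons K kvar)

theorem replK_instK (Q : Tgt .jump) (L K : Tgt .cont) :
    (Q.replK L).instK K = Q.instK (L.instK K) := by
  simp only [Tgt.instK, replK, sub_sub]
  congr 1
  funext n; cases n <;> rfl

/-- A redex `(λk. Q) K` is strongly normalizable if `K` and its contractum are. The structural
rules reproduce such a redex, with the same contractum and a tail of `K` in place of `K`. -/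
theorem xsn_tapp_lamK {K : Tgt .cont} (hK : XSN K) :
    ∀ {Q : Tgt .jump}, XSN (Q.instK K) → XSN (tapp (lamK Q) K) := by
  have hacc := acc_contLt hK
  induction hacc with
  | intro K _ ihK =>
    intro Q hQ
    generalize e : Q.instK K = P at hQ
    induction hQ generalizing Q with
    | intro P hP ihP =>
      subst e
      have hP : XSN (Q.instK K) := Acc.intro _ hP
      refine .intro fun X hX => ?_
      cases hX with
      | betaK => exact hP
      | betaMu _ R K' hR =>
        have ht : ContTail K' (Tgt.lamC (R.instK K'.wkV)) := ⟨_, rfl, hR.instK _⟩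
        refine ihK _ (.inr ht) (hK.of_map Tgt.lamC .lamC |> (hR.instK _).xsn).of_wkV ?_
        rw [replK_instK, lamC_instK]
        exact hP
      | @exchT P P' K' _ h =>
        -- The new argument `K'` is a tail of `K`. The contractum contains the old redex, but with
        -- a reduct of `K` for its argument, hence also smaller in the order.
        have hlt : ContLt K' (Tgt.lamC P) := .inr ⟨_, rfl, h.tailOf⟩
        refine ihK _ hlt ((h.tailOf.xsn (hK.of_map Tgt.lamC .lamC)).of_wkV) ?_
        have hs : XStep (Tgt.lamC P) (Tgt.lamC (P'.instK K'.wkV)) := .lamC h.xstep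
        change XSN (Tgt.tapp ((Tgt.lamK Q).wkK.instK K') ((Tgt.lamC P').instK K'))
        rw [wkK_instK, lamC_instK]
        exact ihK _ (.inl hs) (hK.step hs) (hP.steps (xsteps_instK Q hs))
      | tappL h =>
        cases h with
        | etaK =>
          change XSN (Tgt.tapp ((wkK _).instK K) K) at hP
          rwa [wkK_instK] at hP
        | lamK h => exact ihP _ (h.sub _ _) rfl
      | tappR h => exact ihK _ (.inl h) (hK.step h) (hP.steps (xsteps_instK Q h))

/-- The form of `xsn_tapp_lamK` for the redex created by an exchange, which brings the continuation
`K` to the front. -/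
theorem xsn_exch {P P' : Tgt .jump} {K : Tgt .cont} (h : Exch P P' K.wkV) (hP : XSN P)
    {Q : Tgt .jump} (hQ : XSN (Q.instK K)) : XSN (tapp (lamK Q) K) :=
  xsn_tapp_lamK (h.tailOf.xsn hP).of_wkV hQ

theorem xsn_kapp_lamC {W : Tgt .value} (hW : XSN W) :
    ∀ {Q : Tgt .jump}, XSN (Q.instV W) → XSN (kapp (lamC Q) W) := by
  induction hW with
  | intro W hW ihW =>
    have hW : XSN W := Acc.intro _ hW
    intro Q hQ
    generalize e : Q.instV W = P at hQ
    induction hQ generalizing Q with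
    | intro P hP ihP =>
      subst e
      have hP : XSN (Q.instV W) := Acc.intro _ hP
      refine .intro fun X hX => ?_
      cases hX with
      | betaC => exact hP
      | @exchC _ P' K' _ h =>
        refine xsn_exch h hP.of_instV ?_
        change XSN (Tgt.kapp ((Tgt.lamC P').instK K') (W.wkK.instK K'))
        rw [wkK_instK, lamC_instK]
        exact ihP _ (h.xstep.sub _ _) rfl
      | kappL h =>
        cases h with
        | etaC =>
          change XSN (Tgt.kapp ((wkV _).instV W) W) at hP
          rwa [wkV_instV] at hP
        | lamC h => exact ihP _ (h.sub _ _) rfl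
      | kappR h => exact ihW _ h (hP.steps (xsteps_instV Q h))

theorem xsn_tapp_app_var (x : ℕ) {W : Tgt .value} (hW : XSN W) :
    ∀ {K : Tgt .cont}, XSN K → XSN (tapp (app (var x) W) K) := by
  induction hW with
  | intro W hW ihW =>
    have hW : XSN W := Acc.intro _ hW
    intro K hK
    induction hK with
    | intro K hK ihK =>
      have hK : XSN K := Acc.intro _ hK
      refine .intro fun X hX => ?_
      cases hX with
      | @exchT P P' K' _ h =>
        refine xsn_exch h (hK.of_map Tgt.lamC .lamC) ?_
        change XSN (Tgt.tapp ((Tgt.app (Tgt.var x) W).wkK.instK K') ((Tgt.lamC P').instK K'))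
        rw [wkK_instK, lamC_instK]
        exact ihK _ (.lamC h.xstep)
      | tappL h =>
        cases h with
        | appL h => cases h
        | appR h => exact ihW _ h hK
      | tappR h => exact ihK _ h

theorem instK_wkV_instV (R : Tgt .jump) (K : Tgt .cont) (W : Tgt .value) :
    (R.instK K.wkV).instV W =
      (R.sub (fun n => (scons W var n).wkK) (upK kvar)).instK K := by
  rw [Tgt.instV, instK_sub]
  exact congrArg _ (wkV_instV K W)

theorem xsn_tapp_app_lamV {W : Tgt .value} (hW : XSN W) :
    ∀ {T : Tgt .term} {K : Tgt .cont}, XSN (tapp (T.instV W) K) →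
      XSN (tapp (app (lamV T) W) K) := by
  induction hW with
  | intro W hW ihW =>
    have hW : XSN W := Acc.intro _ hW
    intro T K hT
    generalize e : tapp (T.instV W) K = P at hT
    induction hT generalizing T K with
    | intro P hP ihP =>
      subst e
      have hP : XSN (tapp (T.instV W) K) := Acc.intro _ hP
      refine .intro fun X hX => ?_
      cases hX with
      | betaApp R =>
        refine xsn_kapp_lamC hW ?_
        rw [instK_wkV_instV]
        exact hP.step (.betaK _ _)
      | @exchT P P' K' _ h =>
        refine xsn_exch h (hP.of_map (fun Q => Tgt.tapp (T.instV W) (Tgt.lamC Q))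
          fun h => .tappR (.lamC h)) ?_
        change XSN (Tgt.tapp ((Tgt.app (Tgt.lamV T) W).wkK.instK K') ((Tgt.lamC P').instK K'))
        rw [wkK_instK, lamC_instK]
        exact ihP _ (.tappR (.lamC h.xstep)) rfl
      | tappL h =>
        cases h with
        | betaV => exact hP
        | appL h =>
          cases h with
          | etaV =>
            change XSN (Tgt.tapp (Tgt.app ((wkV _).instV W) W) K) at hP
            rwa [wkV_instV] at hP
          | lamV h => exact ihP _ (.tappL (h.sub _ _)) rfl
        | appR h =>
          exact ihW _ h (hP.steps ((xsteps_instV T h).lift (fun T => Tgt.tapp T K)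
            fun _ _ h => .tappL h))
      | tappR h => exact ihP _ (.tappR h) rfl

theorem xsn_app_lamV {W : Tgt .value} (hW : XSN W) :
    ∀ {T : Tgt .term}, XSN (T.instV W) → XSN (app (lamV T) W) := by
  induction hW with
  | intro W _ ihW =>
    intro T hT
    generalize e : T.instV W = P at hT
    induction hT generalizing T with
    | intro P hP ihP =>
      subst e
      have hP : XSN (T.instV W) := Acc.intro _ hP
      refine .intro fun X hX => ?_
      cases hX with
      | betaV => exact hP
      | appL h =>
        cases h with
        | etaV =>
          change XSN (Tgt.app ((wkV _).instV W) W) at hP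
          rwa [wkV_instV] at hP
        | lamV h => exact ihP _ (h.sub _ _) rfl
      | appR h => exact ihW _ h (hP.steps (xsteps_instV T h))

theorem xsn_lamV {T : Tgt .term} (hT : XSN T) : XSN (lamV T) := by
  induction hT with
  | intro T hT ih =>
    refine .intro fun X hX => ?_
    cases hX with
    | etaV =>
      have hT : XSN (Tgt.app X.wkV (Tgt.var 0)) := Acc.intro _ hT
      exact (hT.of_map (fun W => Tgt.app W _) .appL).of_wkV
    | lamV h => exact ih _ h

theorem xsn_lamC {Q : Tgt .jump} (hQ : XSN Q) : XSN (lamC Q) := by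
  induction hQ with
  | intro Q hQ ih =>
    refine .intro fun X hX => ?_
    cases hX with
    | etaC =>
      have hQ : XSN (Tgt.kapp X.wkV (Tgt.var 0)) := Acc.intro _ hQ
      exact (hQ.of_map (fun K => Tgt.kapp K _) .kappL).of_wkV
    | lamC h => exact ih _ h

theorem xsn_lamK {Q : Tgt .jump} (hQ : XSN Q) : XSN (lamK Q) := by
  induction hQ with
  | intro Q hQ ih =>
    refine .intro fun X hX => ?_
    cases hX with
    | etaK =>
      have hQ : XSN (Tgt.tapp X.wkK (Tgt.kvar 0)) := Acc.intro _ hQ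
      exact (hQ.of_map (fun T => Tgt.tapp T _) .tappL).of_map wkK fun h => h.ren _ _
    | lamK h => exact ih _ h

/-- The inductive description of strong normalizability by head reduction: a redex at the head is
admitted if its contractum and the argument, which may be erased, are. -/
inductive HeadSN : {s : TSort} → Tgt s → Prop
  | var (x : ℕ) : HeadSN (var x)
  | lamV {T : Tgt .term} : HeadSN T → HeadSN (lamV T)
  | kvar (k : ℕ) : HeadSN (kvar k)
  | lamC {Q : Tgt .jump} : HeadSN Q → HeadSN (lamC Q)
  | lamK {Q : Tgt .jump} : HeadSN Q → HeadSN (lamK Q)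
  | appVar (x : ℕ) {W : Tgt .value} : HeadSN W → HeadSN (app (Tgt.var x) W)
  | appLam {T : Tgt .term} {W : Tgt .value} : HeadSN W → HeadSN (T.instV W) →
      HeadSN (app (Tgt.lamV T) W)
  | kappVar (k : ℕ) {W : Tgt .value} : HeadSN W → HeadSN (kapp (Tgt.kvar k) W)
  | kappLam {Q : Tgt .jump} {W : Tgt .value} : HeadSN W → HeadSN (Q.instV W) →
      HeadSN (kapp (Tgt.lamC Q) W)
  | tappLamK {Q : Tgt .jump} {K : Tgt .cont} : HeadSN K → HeadSN (Q.instK K) →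
      HeadSN (tapp (Tgt.lamK Q) K)
  | tappAppVar (x : ℕ) {W : Tgt .value} {K : Tgt .cont} : HeadSN W → HeadSN K →
      HeadSN (tapp (app (Tgt.var x) W) K)
  | tappAppLam {T : Tgt .term} {W : Tgt .value} {K : Tgt .cont} : HeadSN W →
      HeadSN (tapp (T.instV W) K) → HeadSN (tapp (app (Tgt.lamV T) W) K)

theorem HeadSN.xsn {s : TSort} {P : Tgt s} (h : HeadSN P) : XSN P := by
  induction h with
  | var x => exact .intro fun X hX => by cases hX
  | lamV _ ih => exact xsn_lamV ih
  | kvar k => exact .intro fun X hX => by cases hX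
  | lamC _ ih => exact xsn_lamC ih
  | lamK _ ih => exact xsn_lamK ih
  | appVar x _ ih =>
    clear * - ih
    induction ih with
    | intro W _ ih =>
      refine .intro fun X hX => ?_
      cases hX with
      | appL h => cases h
      | appR h => exact ih _ h
  | appLam _ _ ih₁ ih₂ => exact xsn_app_lamV ih₁ ih₂
  | kappVar k _ ih =>
    clear * - ih
    induction ih with
    | intro W _ ih =>
      refine .intro fun X hX => ?_
      cases hX with
      | kappL h => cases h
      | kappR h => exact ih _ h
  | kappLam _ _ ih₁ ih₂ => exact xsn_kapp_lamC ih₁ ih₂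
  | tappLamK _ _ ih₁ ih₂ => exact xsn_tapp_lamK ih₁ ih₂
  | tappAppVar x _ _ ih₁ ih₂ => exact xsn_tapp_app_var x ih₁ ih₂
  | tappAppLam _ _ ih₁ ih₂ => exact xsn_tapp_app_lamV ih₁ ih₂

theorem XSN.sn {s : TSort} {P : Tgt s} (h : XSN P) : StronglyNormalizable Step P := by
  induction h with
  | intro P _ ih => exact Acc.intro _ fun P' h => ih P' h.xstep

/-- `Subterm X P`: the expression `P` occurs in `X`. -/
inductive Subterm {t : TSort} (X : Tgt t) : {s : TSort} → Tgt s → Prop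
  | refl : Subterm X X
  | lamK {Q : Tgt .jump} : Subterm X (lamK Q) → Subterm X Q
  | appL {W₁ W₂ : Tgt .value} : Subterm X (app W₁ W₂) → Subterm X W₁
  | appR {W₁ W₂ : Tgt .value} : Subterm X (app W₁ W₂) → Subterm X W₂
  | kappL {K : Tgt .cont} {W : Tgt .value} : Subterm X (kapp K W) → Subterm X K
  | kappR {K : Tgt .cont} {W : Tgt .value} : Subterm X (kapp K W) → Subterm X W
  | tappL {T : Tgt .term} {K : Tgt .cont} : Subterm X (tapp T K) → Subterm X T
  | tappR {T : Tgt .term} {K : Tgt .cont} : Subterm X (tapp T K) → Subterm X K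
  | lamV {T : Tgt .term} : Subterm X (lamV T) → Subterm X T
  | lamC {Q : Tgt .jump} : Subterm X (lamC Q) → Subterm X Q

theorem Subterm.lift_step {t s : TSort} {X : Tgt t} {P : Tgt s} (h : Subterm X P) :
    ∀ {P'}, Step P P' → ∃ X', Step X X' ∧ Subterm X' P' := by
  induction h with
  | refl => exact fun h => ⟨_, h, .refl⟩
  | lamK _ ih => intro _ h; obtain ⟨X', h₁, h₂⟩ := ih (.lamK h); exact ⟨X', h₁, .lamK h₂⟩
  | appL _ ih => intro _ h; obtain ⟨X', h₁, h₂⟩ := ih (.appL h); exact ⟨X', h₁, .appL h₂⟩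
  | appR _ ih => intro _ h; obtain ⟨X', h₁, h₂⟩ := ih (.appR h); exact ⟨X', h₁, .appR h₂⟩
  | kappL _ ih => intro _ h; obtain ⟨X', h₁, h₂⟩ := ih (.kappL h); exact ⟨X', h₁, .kappL h₂⟩
  | kappR _ ih => intro _ h; obtain ⟨X', h₁, h₂⟩ := ih (.kappR h); exact ⟨X', h₁, .kappR h₂⟩
  | tappL _ ih => intro _ h; obtain ⟨X', h₁, h₂⟩ := ih (.tappL h); exact ⟨X', h₁, .tappL h₂⟩
  | tappR _ ih => intro _ h; obtain ⟨X', h₁, h₂⟩ := ih (.tappR h); exact ⟨X', h₁, .tappR h₂⟩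
  | lamV _ ih => intro _ h; obtain ⟨X', h₁, h₂⟩ := ih (.lamV h); exact ⟨X', h₁, .lamV h₂⟩
  | lamC _ ih => intro _ h; obtain ⟨X', h₁, h₂⟩ := ih (.lamC h); exact ⟨X', h₁, .lamC h₂⟩

theorem headSN_of_subterm {t : TSort} {X : Tgt t} (hX : StronglyNormalizable Step X) :
    ∀ {s : TSort} {P : Tgt s}, Subterm X P → HeadSN P := by
  induction hX with
  | intro X _ ih =>
    -- contracta lie below a reduct of `X`; the remaining premises are smaller expressions
    have red : ∀ {s : TSort} {P P' : Tgt s}, Subterm X P → Step P P' → HeadSN P' :=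
      fun hP h => by
        obtain ⟨X', h₁, h₂⟩ := hP.lift_step h
        exact ih X' h₁ h₂
    intro s P
    induction P with
    | lamK Q ihQ => exact fun h => .lamK (ihQ (.lamK h))
    | app W₁ W₂ _ ih₂ =>
      intro h
      cases W₁ with
      | var x => exact .appVar x (ih₂ (.appR h))
      | lamV T => exact .appLam (ih₂ (.appR h)) (red h (.betaV _ _))
    | kapp K W _ ihW =>
      intro h
      cases K with
      | kvar k => exact .kappVar k (ihW (.kappR h))
      | lamC Q => exact .kappLam (ihW (.kappR h)) (red h (.betaC _ _))
    | tapp T K ihT ihK =>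
      intro h
      cases T with
      | lamK Q => exact .tappLamK (ihK (.tappR h)) (red h (.betaK _ _))
      | app W₁ W₂ =>
        cases W₁ with
        | var x =>
          cases ihT (.tappL h) with
          | appVar _ h₂ => exact .tappAppVar x h₂ (ihK (.tappR h))
        | lamV T =>
          cases ihT (.tappL h) with
          | appLam h₂ _ => exact .tappAppLam h₂ (red h (.tappL (.betaV _ _)))
    | var x => exact fun _ => .var x
    | lamV T ihT => exact fun h => .lamV (ihT (.lamV h))
    | kvar k => exact fun _ => .kvar k
    | lamC Q ihQ => exact fun h => .lamC (ihQ (.lamC h))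

/-- With `HeadSN.xsn`, the structural rules do not affect strong normalizability. -/
theorem sn_iff_headSN {s : TSort} {P : Tgt s} : StronglyNormalizable Step P ↔ HeadSN P :=
  ⟨fun h => headSN_of_subterm h .refl, fun h => h.xsn.sn⟩

theorem instV_ren {s : TSort} (P : Tgt s) (W : Tgt .value) (ρ κ : ℕ → ℕ) :
    (P.instV W).ren ρ κ = (P.ren (lift ρ) κ).instV (W.ren ρ κ) := by
  simp only [instV, sub_ren, ren_sub]
  congr 1
  funext n; cases n <;> rfl

theorem instK_ren {s : TSort} (P : Tgt s) (K : Tgt .cont) (ρ κ : ℕ → ℕ) :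
    (P.instK K).ren ρ κ = (P.ren ρ (lift κ)).instK (K.ren ρ κ) := by
  simp only [instK, sub_ren, ren_sub]
  congr 1
  funext n; cases n <;> rfl

theorem HeadSN.ren {s : TSort} {P : Tgt s} (h : HeadSN P) :
    ∀ ρ κ : ℕ → ℕ, HeadSN (P.ren ρ κ) := by
  induction h with
  | var x => exact fun _ _ => .var _
  | lamV _ ih => exact fun _ _ => .lamV (ih _ _)
  | kvar k => exact fun _ _ => .kvar _
  | lamC _ ih => exact fun _ _ => .lamC (ih _ _)
  | lamK _ ih => exact fun _ _ => .lamK (ih _ _)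
  | appVar x _ ih => exact fun _ _ => .appVar _ (ih _ _)
  | appLam _ _ ih₁ ih₂ =>
    exact fun ρ κ => .appLam (ih₁ ρ κ) (by rw [← instV_ren]; exact ih₂ ρ κ)
  | kappVar k _ ih => exact fun _ _ => .kappVar _ (ih _ _)
  | kappLam _ _ ih₁ ih₂ =>
    exact fun ρ κ => .kappLam (ih₁ ρ κ) (by rw [← instV_ren]; exact ih₂ ρ κ)
  | tappLamK _ _ ih₁ ih₂ =>
    exact fun ρ κ => .tappLamK (ih₁ ρ κ) (by rw [← instK_ren]; exact ih₂ ρ κ)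
  | tappAppVar x _ _ ih₁ ih₂ => exact fun ρ κ => .tappAppVar _ (ih₁ ρ κ) (ih₂ ρ κ)
  | tappAppLam _ _ ih₁ ih₂ =>
    exact fun ρ κ => .tappAppLam (ih₁ ρ κ) (by rw [← instV_ren]; exact ih₂ ρ κ)

end Tgt
end CCV

namespace CCV
namespace Raw

/-! ### Substitution in the source calculus -/

/-- The extension of a substitution under a binder of an ordinary variable. -/
def up (σ : ℕ → Raw .value) : ℕ → Raw .value := scons (var 0) fun n => (σ n).wkV

theorem sub_ren {s : Srt} (M : Raw s) : ∀ {σ σ' : ℕ → Raw .value} {ρ ρ' κ : ℕ → ℕ},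
    (∀ n, (σ n).ren ρ κ = σ' (ρ' n)) → (M.sub σ).ren ρ κ = (M.ren ρ' κ).sub σ' := by
  have hup : ∀ {σ σ' : ℕ → Raw .value} {ρ ρ' κ : ℕ → ℕ}, (∀ n, (σ n).ren ρ κ = σ' (ρ' n)) →
      ∀ n, (up σ n).ren (lift ρ) κ = up σ' (lift ρ' n) := fun h n => by
    cases n
    · rfl
    · exact (wkV_ren ..).trans (congrArg wkV (h _))
  induction M with
  | var x => intro _ _ _ _ _ h; exact h x
  | lam M ih => intro _ _ _ _ _ h; exact congrArg lam (ih (hup h))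
  | val V ih => intro _ _ _ _ _ h; exact congrArg val (ih h)
  | app M N ih₁ ih₂ => intro _ _ _ _ _ h; exact congrArg₂ app (ih₁ h) (ih₂ h)
  | letT L M ih₁ ih₂ => intro _ _ _ _ _ h; exact congrArg₂ letT (ih₁ (hup h)) (ih₂ h)
  | mu J ih =>
    intro _ _ _ _ _ h
    exact congrArg mu (ih fun n => (wkK_ren ..).trans (congrArg wkK (h n)))
  | jmp k M ih => intro _ _ _ _ _ h; exact congrArg (jmp _) (ih h)
  | letJ J M ih₁ ih₂ => intro _ _ _ _ _ h; exact congrArg₂ letJ (ih₁ (hup h)) (ih₂ h)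

theorem inst_ren {s : Srt} (M : Raw s) (V : Raw .value) (ρ κ : ℕ → ℕ) :
    (M.inst V).ren ρ κ = (M.ren (lift ρ) κ).inst (V.ren ρ κ) :=
  sub_ren M fun n => by cases n <;> rfl

theorem instK_ren {s : Srt} (J : Raw s) (l : ℕ) (ρ κ : ℕ → ℕ) :
    (J.instK l).ren ρ κ = (J.ren ρ (lift κ)).instK (κ l) := by
  simp only [instK, ren_ren]
  congr 1
  funext n; cases n <;> rfl

theorem ren_id {s : Srt} (M : Raw s) : M.ren id id = M := by
  induction M <;> simp_all [ren, lift_id]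

theorem jumpSub_ren {s : Srt} (M : Raw s) : ∀ (k : ℕ) (L : Raw .term) (ρ κ : ℕ → ℕ),
    (∀ j, κ j = κ k → j = k) →
      (M.jumpSub k L).ren ρ κ = (M.ren ρ κ).jumpSub (κ k) (L.ren (lift ρ) κ) := by
  induction M with
  | var x => intros; rfl
  | lam M ih => intro k L ρ κ h; simp only [jumpSub, ren, ih _ _ _ _ h, wkV'_ren]
  | val V ih => intro k L ρ κ h; simp only [jumpSub, ren, ih _ _ _ _ h]
  | app M N ih₁ ih₂ => intro k L ρ κ h; simp only [jumpSub, ren, ih₁ _ _ _ _ h, ih₂ _ _ _ _ h]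
  | letT P N ih₁ ih₂ =>
    intro k L ρ κ h; simp only [jumpSub, ren, ih₁ _ _ _ _ h, ih₂ _ _ _ _ h, wkV'_ren]
  | mu J ih =>
    intro k L ρ κ h
    have h' : ∀ j, lift κ j = lift κ (k + 1) → j = k + 1 := fun j hj => by
      cases j with
      | zero => cases hj
      | succ j => exact congrArg (· + 1) (h j (Nat.succ.inj hj))
    simp only [jumpSub, ren, ih _ _ _ _ h', wkK_ren]
    rfl
  | jmp j N ih =>
    intro k L ρ κ h
    by_cases e : j = k
    · subst e; simp only [jumpSub, ren, if_true, ih _ _ _ _ h]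
    · simp only [jumpSub, ren, if_neg e, if_neg (mt (h j) e), ih _ _ _ _ h]
  | letJ J N ih₁ ih₂ =>
    intro k L ρ κ h; simp only [jumpSub, ren, ih₁ _ _ _ _ h, ih₂ _ _ _ _ h, wkV'_ren]

theorem isVal_sub (M : Raw .term) (σ : ℕ → Raw .value) : (M.sub σ).IsVal ↔ M.IsVal := by
  cases M <;> simp [IsVal, sub]

theorem isVal_jumpSub (M : Raw .term) (k : ℕ) (L : Raw .term) :
    (M.jumpSub k L).IsVal ↔ M.IsVal := by
  cases M <;> simp [IsVal, jumpSub]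

/-! ### The colon translation and substitution -/

theorem star_ren (V : Raw .value) (ρ κ : ℕ → ℕ) : star (V.ren ρ κ) = (star V).ren ρ κ :=
  ren_colon.1 V ρ κ

theorem star_wkV (V : Raw .value) : star V.wkV = (star V).wkV := star_ren ..

theorem colon_ren (M : Raw .term) (K : Tgt .cont) (ρ κ : ℕ → ℕ) :
    colon (M.ren ρ κ) (K.ren ρ κ) = (colon M K).ren ρ κ := ren_colon.2.1 M K ρ κ

theorem colonJ_ren (J : Raw .jump) (ρ κ : ℕ → ℕ) : colonJ (J.ren ρ κ) = (colonJ J).ren ρ κ :=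
  ren_colon.2.2 J ρ κ

theorem colon_app_val_left (V : Raw .value) {N : Raw .term} (hN : ¬ N.IsVal) (K : Tgt .cont) :
    colon (app (val V) N) K =
      colon N (.lamC (.tapp (.app (star V).wkV (.var 0)) K.wkV)) := by
  rw [colon, star_wkV]; exact fun V h => hN ⟨V, h⟩

theorem colon_app_val_right {N : Raw .term} (hN : ¬ N.IsVal) (V : Raw .value) (K : Tgt .cont) :
    colon (app N (val V)) K =
      colon N (.lamC (.tapp (.app (.var 0) (star V).wkV) K.wkV)) := by
  rw [colon, star_wkV]; exact fun V h => hN ⟨V, h⟩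

theorem colon_app_nonval {N₁ N₂ : Raw .term} (h₁ : ¬ N₁.IsVal) (h₂ : ¬ N₂.IsVal)
    (K : Tgt .cont) : colon (app N₁ N₂) K =
      colon N₁ (.lamC (colon N₂.wkV (.lamC (.tapp (.app (.var 1) (.var 0)) K.wkV.wkV)))) :=
  colon_nn (fun V h => h₁ ⟨V, h⟩) (fun V h => h₂ ⟨V, h⟩) K

/-- Induction along the clauses of the colon translation. -/
theorem translation_induction {P : Raw .value → Prop} {Q : Raw .term → Prop}
    {R : Raw .jump → Prop} (var : ∀ x, P (var x)) (lam : ∀ M, Q M.wkK → P (lam M))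
    (val : ∀ V, P V → Q (val V))
    (app_vv : ∀ V W, P V → P W → Q (app (.val V) (.val W)))
    (app_vn : ∀ V N, ¬ N.IsVal → P V → Q N → Q (app (.val V) N))
    (app_nv : ∀ N V, ¬ N.IsVal → Q N → P V → Q (app N (.val V)))
    (app_nn : ∀ N₁ N₂, ¬ N₁.IsVal → ¬ N₂.IsVal → Q N₁ → Q N₂.wkV → Q (app N₁ N₂))
    (letT : ∀ L M, Q L → Q M → Q (letT L M)) (mu : ∀ J, R J → Q (mu J))
    (jmp : ∀ k M, Q M → R (jmp k M)) (letJ : ∀ J M, R J → Q M → R (letJ J M)) :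
    (∀ V, P V) ∧ (∀ M, Q M) ∧ ∀ J, R J := by
  have H : ∀ n, (∀ V, V.size ≤ n → P V) ∧ (∀ M, M.size ≤ n → Q M) ∧
      ∀ J, J.size ≤ n → R J := by
    intro n
    induction n with
    | zero =>
      refine ⟨fun V h => ?_, fun M h => ?_, fun J h => ?_⟩
      · cases V <;> simp [size] at h
      · cases M <;> simp [size] at h
      · cases J <;> simp [size] at h
    | succ n ih =>
      obtain ⟨hP, hQ, hR⟩ := ih
      refine ⟨fun V h => ?_, fun M h => ?_, fun J h => ?_⟩
      · cases V with
        | var x => exact var x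
        | lam M => exact lam M (hQ _ (by simp only [size] at h; simp; omega))
      · cases M with
        | val V => exact val V (hP _ (by simp only [size] at h; omega))
        | app M N =>
          simp only [size] at h
          by_cases hM : M.IsVal <;> by_cases hN : N.IsVal
          · obtain ⟨V, rfl⟩ := hM
            obtain ⟨W, rfl⟩ := hN
            simp only [size] at h
            exact app_vv V W (hP _ (by omega)) (hP _ (by omega))
          · obtain ⟨V, rfl⟩ := hM
            simp only [size] at h
            exact app_vn V N hN (hP _ (by omega)) (hQ _ (by omega))
          · obtain ⟨V, rfl⟩ := hN
            simp only [size] at h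
            exact app_nv M V hM (hQ _ (by omega)) (hP _ (by omega))
          · exact app_nn M N hM hN (hQ _ (by omega)) (hQ _ (by simp; omega))
        | letT L M =>
          simp only [size] at h
          exact letT L M (hQ _ (by omega)) (hQ _ (by omega))
        | mu J => exact mu J (hR _ (by simp only [size] at h; omega))
      · cases J with
        | jmp k M => exact jmp k M (hQ _ (by simp only [size] at h; omega))
        | letJ J M =>
          simp only [size] at h
          exact letJ J M (hR _ (by omega)) (hQ _ (by omega))
  exact ⟨fun V => (H _).1 V le_rfl, fun M => (H _).2.1 M le_rfl, fun J => (H _).2.2 J le_rfl⟩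

/-- Induction along the clauses of the colon translation of terms, jumps being left aside. -/
theorem colon_induction {Q : Raw .term → Prop} (val : ∀ V, Q (val V))
    (app_vv : ∀ V W, Q (app (.val V) (.val W)))
    (app_vn : ∀ V N, ¬ N.IsVal → Q N → Q (app (.val V) N))
    (app_nv : ∀ N V, ¬ N.IsVal → Q N → Q (app N (.val V)))
    (app_nn : ∀ N₁ N₂, ¬ N₁.IsVal → ¬ N₂.IsVal → Q N₁ → Q N₂.wkV → Q (app N₁ N₂))
    (letT : ∀ L M, Q L → Q M → Q (letT L M)) (mu : ∀ J, Q (mu J)) (M : Raw .term) : Q M :=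
  (translation_induction (P := fun _ => True) (R := fun _ => True) (fun _ => ⟨⟩) (fun _ _ => ⟨⟩)
    (fun V _ => val V) (fun V W _ _ => app_vv V W) (fun V N hN _ h => app_vn V N hN h)
    (fun N V hN h _ => app_nv N V hN h) app_nn letT (fun J _ => mu J) (fun _ _ _ => ⟨⟩)
    (fun _ _ _ _ => ⟨⟩)).2.1 M

open Tgt (upV upK)

/-- A substitution that acts as the renaming `ρ'`, `κ'` on the variables in the image of the
renaming `ρ`, `κ`. -/
structure Agree (ρ κ ρ' κ' : ℕ → ℕ) (σ : ℕ → Tgt .value) (θ : ℕ → Tgt .cont) : Prop where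
  val : ∀ n, σ (ρ n) = .var (ρ' n)
  cont : ∀ n, θ (κ n) = .kvar (κ' n)

theorem Agree.upV {ρ κ ρ' κ' : ℕ → ℕ} {σ : ℕ → Tgt .value} {θ : ℕ → Tgt .cont}
    (h : Agree ρ κ ρ' κ' σ θ) :
    Agree (lift ρ) κ (lift ρ') κ' (upV σ) fun n => (θ n).wkV where
  val n := by
    cases n
    · rfl
    · exact congrArg Tgt.wkV (h.val _)
  cont n := congrArg Tgt.wkV (h.cont n)

theorem Agree.upK {ρ κ ρ' κ' : ℕ → ℕ} {σ : ℕ → Tgt .value} {θ : ℕ → Tgt .cont}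
    (h : Agree ρ κ ρ' κ' σ θ) :
    Agree ρ (lift κ) ρ' (lift κ') (fun n => (σ n).wkK) (upK θ) where
  val n := congrArg Tgt.wkK (h.val n)
  cont n := by
    cases n
    · rfl
    · exact congrArg Tgt.wkK (h.cont _)

/-- The translation of a renamed expression, under a substitution that acts on its variables as a
renaming, but may act on the continuation `K` in any way. -/
theorem ren_colon_sub :
    (∀ (V : Raw .value) {ρ κ ρ' κ' σ θ}, Agree ρ κ ρ' κ' σ θ →
      (star (V.ren ρ κ)).sub σ θ = star (V.ren ρ' κ')) ∧
    (∀ (M : Raw .term) {ρ κ ρ' κ' σ θ}, Agree ρ κ ρ' κ' σ θ → ∀ K : Tgt .cont,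
      (colon (M.ren ρ κ) K).sub σ θ = colon (M.ren ρ' κ') (K.sub σ θ)) ∧
    (∀ (J : Raw .jump) {ρ κ ρ' κ' σ θ}, Agree ρ κ ρ' κ' σ θ →
      (colonJ (J.ren ρ κ)).sub σ θ = colonJ (J.ren ρ' κ')) := by
  apply translation_induction
  case var => intro x ρ κ ρ' κ' σ θ h; simp only [ren, star, Tgt.sub, h.val]
  case lam =>
    intro M ih ρ κ ρ' κ' σ θ h
    simp only [ren, star, Tgt.sub_lamV, Tgt.sub_lamK]
    rw [← wkK_ren, ih h.upV.upK, wkK_ren]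
    rfl
  case val => intro V ih ρ κ ρ' κ' σ θ h K; simp only [ren, colon, Tgt.sub, ih h]
  case app_vv =>
    intro V W ih₁ ih₂ ρ κ ρ' κ' σ θ h K; simp only [ren, colon, Tgt.sub, ih₁ h, ih₂ h]
  case app_vn =>
    intro V N hN ihV ihN ρ κ ρ' κ' σ θ h K
    simp only [ren]
    rw [colon_app_val_left _ (by rwa [isVal_ren]), colon_app_val_left _ (by rwa [isVal_ren]),
      ihN h, Tgt.sub_lamC, Tgt.sub, Tgt.sub, Tgt.wkV_sub_up, Tgt.wkV_sub_up, ihV h]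
    rfl
  case app_nv =>
    intro N V hN ihN ihV ρ κ ρ' κ' σ θ h K
    simp only [ren]
    rw [colon_app_val_right (by rwa [isVal_ren]), colon_app_val_right (by rwa [isVal_ren]),
      ihN h, Tgt.sub_lamC, Tgt.sub, Tgt.sub, Tgt.wkV_sub_up, Tgt.wkV_sub_up, ihV h]
    rfl
  case app_nn =>
    intro N₁ N₂ h₁ h₂ ih₁ ih₂ ρ κ ρ' κ' σ θ h K
    simp only [ren]
    rw [colon_app_nonval (by rwa [isVal_ren]) (by rwa [isVal_ren]),
      colon_app_nonval (by rwa [isVal_ren]) (by rwa [isVal_ren]), ih₁ h, Tgt.sub_lamC,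
      ← wkV_ren, ih₂ h.upV, wkV_ren, Tgt.sub_lamC, Tgt.sub, Tgt.sub, Tgt.wkV_sub_up,
      Tgt.wkV_sub_up]
    rfl
  case letT =>
    intro L M ihL ihM ρ κ ρ' κ' σ θ h K
    simp only [ren, colon]
    rw [ihM h, Tgt.sub_lamC, ihL h.upV, Tgt.wkV_sub_up]
  case mu =>
    intro J ih ρ κ ρ' κ' σ θ h K
    simp only [ren, colon, Tgt.sub]
    exact congrArg (fun Q => Tgt.tapp (.lamK Q) _) (ih h.upK)
  case jmp =>
    intro k M ih ρ κ ρ' κ' σ θ h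
    simp only [ren, colonJ, ih h, Tgt.sub, h.cont]
  case letJ =>
    intro J M ihJ ihM ρ κ ρ' κ' σ θ h
    simp only [ren, colonJ, ihM h]
    rw [Tgt.sub_lamC, ihJ h.upV]

theorem colon_wkK_instK (M : Raw .term) (K' K : Tgt .cont) :
    (colon M.wkK K').instK K = colon M (K'.instK K) := by
  have h : Agree id Nat.succ id id Tgt.var (scons K Tgt.kvar) := ⟨fun _ => rfl, fun _ => rfl⟩
  have := ren_colon_sub.2.1 M h K'
  rwa [ren_id] at this

theorem colon_wkV_instV (M : Raw .term) (K : Tgt .cont) (W : Tgt .value) :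
    (colon M.wkV K).instV W = colon M (K.instV W) := by
  have h : Agree Nat.succ id id id (scons W Tgt.var) Tgt.kvar := ⟨fun _ => rfl, fun _ => rfl⟩
  have := ren_colon_sub.2.1 M h K
  rwa [ren_id] at this

theorem colon_sub_star :
    (∀ (V : Raw .value) {σ : ℕ → Raw .value} {σ' : ℕ → Tgt .value}, (∀ n, σ' n = star (σ n)) →
      (star V).sub σ' .kvar = star (V.sub σ)) ∧
    (∀ (M : Raw .term) {σ : ℕ → Raw .value} {σ' : ℕ → Tgt .value}, (∀ n, σ' n = star (σ n)) →
      ∀ K : Tgt .cont, (colon M K).sub σ' .kvar = colon (M.sub σ) (K.sub σ' .kvar)) ∧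
    (∀ (J : Raw .jump) {σ : ℕ → Raw .value} {σ' : ℕ → Tgt .value}, (∀ n, σ' n = star (σ n)) →
      (colonJ J).sub σ' .kvar = colonJ (J.sub σ)) := by
  have hV : ∀ {σ : ℕ → Raw .value} {σ' : ℕ → Tgt .value}, (∀ n, σ' n = star (σ n)) →
      ∀ n, upV σ' n = star (up σ n) := fun h n => by
    cases n
    · exact (star.eq_1 0).symm
    · exact (congrArg Tgt.wkV (h _)).trans (star_wkV _).symm
  have hK : ∀ {σ : ℕ → Raw .value} {σ' : ℕ → Tgt .value}, (∀ n, σ' n = star (σ n)) →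
      ∀ n, (σ' n).wkK = star (σ n).wkK := fun h n =>
    (congrArg Tgt.wkK (h _)).trans (star_ren ..).symm
  have wkV_up : ∀ {s : Srt} (M : Raw s) (σ : ℕ → Raw .value),
      M.wkV.sub (up σ) = (M.sub σ).wkV := fun M σ => (sub_ren M fun n => rfl).symm
  have wkK_up : ∀ {s : Srt} (M : Raw s) (σ : ℕ → Raw .value),
      M.wkK.sub (fun n => (σ n).wkK) = (M.sub σ).wkK := fun M σ => (sub_ren M fun n => rfl).symm
  have sub_C : ∀ (Q : Tgt .jump) (σ : ℕ → Tgt .value),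
      (Tgt.lamC Q).sub σ .kvar = .lamC (Q.sub (upV σ) .kvar) := fun _ _ => rfl
  have wk_C : ∀ {s : TSort} (Q : Tgt s) (σ : ℕ → Tgt .value),
      Q.wkV.sub (upV σ) .kvar = (Q.sub σ .kvar).wkV := fun Q σ => Q.wkV_sub_up σ .kvar
  apply translation_induction
  case var => intro x σ σ' h; simp only [sub, star, Tgt.sub, h]
  case lam =>
    intro M ih σ σ' h
    simp only [sub, star, Tgt.sub_lamV, Tgt.sub_lamK]
    have := ih (hK (hV h)) (.kvar 0)
    rw [wkK_up] at this
    refine congrArg (fun Q => Tgt.lamV (.lamK Q)) (Eq.trans ?_ this)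
    congr 1
    exact Tgt.upK_kvar
  case val => intro V ih σ σ' h K; simp only [sub, colon, Tgt.sub, ih h]
  case app_vv =>
    intro V W ih₁ ih₂ σ σ' h K; simp only [sub, colon, Tgt.sub, ih₁ h, ih₂ h]
  case app_vn =>
    intro V N hN ihV ihN σ σ' h K
    simp only [sub]
    rw [colon_app_val_left _ hN, colon_app_val_left _ (by rwa [isVal_sub]), ihN h, sub_C,
      Tgt.sub, Tgt.sub, wk_C, wk_C, ihV h]
    rfl
  case app_nv =>
    intro N V hN ihN ihV σ σ' h K
    simp only [sub]
    rw [colon_app_val_right hN, colon_app_val_right (by rwa [isVal_sub]), ihN h, sub_C,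
      Tgt.sub, Tgt.sub, wk_C, wk_C, ihV h]
    rfl
  case app_nn =>
    intro N₁ N₂ h₁ h₂ ih₁ ih₂ σ σ' h K
    simp only [sub]
    rw [colon_app_nonval h₁ h₂, colon_app_nonval (by rwa [isVal_sub]) (by rwa [isVal_sub]),
      ih₁ h, sub_C, ih₂ (hV h), wkV_up, sub_C, Tgt.sub, Tgt.sub, wk_C, wk_C]
    rfl
  case letT =>
    intro L M ihL ihM σ σ' h K
    simp only [sub, colon]
    rw [ihM h, sub_C, ihL (hV h), wk_C]
    rfl
  case mu =>
    intro J ih σ σ' h K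
    simp only [sub, colon]
    rw [Tgt.sub, Tgt.sub_lamK, Tgt.upK_kvar, ih (hK h)]
  case jmp => intro k M ih σ σ' h; simp only [sub, colonJ, ih h, Tgt.sub]
  case letJ =>
    intro J M ihJ ihM σ σ' h
    simp only [sub, colonJ]
    rw [ihM h, sub_C, ihJ (hV h)]
    rfl

theorem colon_instV (M : Raw .term) (V : Raw .value) (K : Tgt .cont) :
    (colon M K).instV (star V) = colon (M.inst V) (K.instV (star V)) :=
  colon_sub_star.2.1 M (fun n => by
    cases n
    · rfl
    · exact (star.eq_1 _).symm) K

/-- The substitution for continuation variables to which `jumpSub k L` corresponds. -/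
def JumpSubst (k : ℕ) (L : Raw .term) (θ : ℕ → Tgt .cont) : Prop :=
  ∀ j, θ j = if j = k then .lamC (colon L (.kvar k)) else .kvar j

theorem JumpSubst.wkV {k : ℕ} {L : Raw .term} {θ : ℕ → Tgt .cont} (h : JumpSubst k L θ) :
    JumpSubst k L.wkV' fun n => (θ n).wkV := by
  intro j
  simp only [h j]
  split
  · exact congrArg Tgt.lamC (colon_ren L (.kvar k) (lift Nat.succ) id).symm
  · rfl

theorem JumpSubst.upK {k : ℕ} {L : Raw .term} {θ : ℕ → Tgt .cont} (h : JumpSubst k L θ) :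
    JumpSubst (k + 1) L.wkK (upK θ) := by
  intro j
  cases j with
  | zero => rfl
  | succ j =>
    simp only [Tgt.upK, scons, h j, Nat.add_right_cancel_iff]
    split
    · exact congrArg Tgt.lamC ((congrArg (fun ρ => (colon L (.kvar k)).ren ρ Nat.succ)
        lift_id).trans (colon_ren L (.kvar k) id Nat.succ).symm)
    · rfl

theorem colon_jumpSub :
    (∀ (V : Raw .value) {k : ℕ} {L : Raw .term} {θ : ℕ → Tgt .cont}, JumpSubst k L θ →
      (star V).sub .var θ = star (V.jumpSub k L)) ∧
    (∀ (M : Raw .term) {k : ℕ} {L : Raw .term} {θ : ℕ → Tgt .cont}, JumpSubst k L θ →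
      ∀ K : Tgt .cont, (colon M K).sub .var θ = colon (M.jumpSub k L) (K.sub .var θ)) ∧
    (∀ (J : Raw .jump) {k : ℕ} {L : Raw .term} {θ : ℕ → Tgt .cont}, JumpSubst k L θ →
      (colonJ J).sub .var θ = colonJ (J.jumpSub k L)) := by
  have wkV_jump : ∀ {s : Srt} (M : Raw s) (k : ℕ) (L : Raw .term),
      M.wkV.jumpSub k L.wkV' = (M.jumpSub k L).wkV := fun M k L =>
    (jumpSub_ren M k L Nat.succ id fun j hj => hj).symm
  have wkK_jump : ∀ {s : Srt} (M : Raw s) (k : ℕ) (L : Raw .term),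
      M.wkK.jumpSub (k + 1) L.wkK = (M.jumpSub k L).wkK := fun M k L => by
    have := jumpSub_ren M k L id Nat.succ fun j hj => Nat.succ.inj hj
    rw [lift_id] at this
    exact this.symm
  have sub_C : ∀ (Q : Tgt .jump) (θ : ℕ → Tgt .cont),
      (Tgt.lamC Q).sub .var θ = .lamC (Q.sub .var fun n => (θ n).wkV) := fun Q θ => by
    rw [Tgt.sub_lamC, Tgt.upV_var]
  have wk_C : ∀ {s : TSort} (Q : Tgt s) (θ : ℕ → Tgt .cont),
      (Q.wkV.sub .var fun n => (θ n).wkV) = (Q.sub .var θ).wkV := fun Q θ => by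
    have := Q.wkV_sub_up .var θ
    rwa [Tgt.upV_var] at this
  apply translation_induction
  case var => intros; simp only [jumpSub, star, Tgt.sub]
  case lam =>
    intro M ih k L θ h
    simp only [jumpSub, star]
    rw [Tgt.sub_lamV, Tgt.upV_var, Tgt.sub_lamK]
    have := ih h.wkV.upK (.kvar 0)
    rw [wkK_jump] at this
    exact congrArg (fun Q => Tgt.lamV (.lamK Q)) this
  case val => intro V ih k L θ h K; simp only [jumpSub, colon, Tgt.sub, ih h]
  case app_vv =>
    intro V W ih₁ ih₂ k L θ h K; simp only [jumpSub, colon, Tgt.sub, ih₁ h, ih₂ h]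
  case app_vn =>
    intro V N hN ihV ihN k L θ h K
    simp only [jumpSub]
    rw [colon_app_val_left _ hN, colon_app_val_left _ (by rwa [isVal_jumpSub]), ihN h, sub_C,
      Tgt.sub, Tgt.sub, wk_C, wk_C, ihV h, Tgt.sub]
  case app_nv =>
    intro N V hN ihN ihV k L θ h K
    simp only [jumpSub]
    rw [colon_app_val_right hN, colon_app_val_right (by rwa [isVal_jumpSub]), ihN h, sub_C,
      Tgt.sub, Tgt.sub, wk_C, wk_C, ihV h, Tgt.sub]
  case app_nn =>
    intro N₁ N₂ h₁ h₂ ih₁ ih₂ k L θ h K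
    simp only [jumpSub]
    rw [colon_app_nonval h₁ h₂,
      colon_app_nonval (by rwa [isVal_jumpSub]) (by rwa [isVal_jumpSub]), ih₁ h, sub_C,
      ih₂ h.wkV, wkV_jump, sub_C, Tgt.sub, Tgt.sub, wk_C, wk_C, Tgt.sub, Tgt.sub]
  case letT =>
    intro P M ihP ihM k L θ h K
    simp only [jumpSub, colon]
    rw [ihM h, sub_C, ihP h.wkV, wk_C]
  case mu =>
    intro J ih k L θ h K
    simp only [jumpSub, colon]
    rw [Tgt.sub, Tgt.sub_lamK]
    exact congrArg (fun Q => Tgt.tapp (.lamK Q) _) (ih h.upK)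
  case jmp =>
    intro j M ih k L θ h
    rw [colonJ, ih h, Tgt.sub, h j, jumpSub]
    split
    · next e => subst e; rw [colonJ, colon]; rfl
    · rw [colonJ]
  case letJ =>
    intro J M ihJ ihM k L θ h
    simp only [jumpSub, colonJ]
    rw [ihM h, sub_C, ihJ h.wkV]

/-- The context substitution of the source is a substitution for `k` in the target. -/
theorem colonJ_jumpSub (J : Raw .jump) (M : Raw .term) :
    colonJ (J.jumpSub 0 M.wkK) = (colonJ J).replK (.lamC (colon M.wkK (.kvar 0))) :=
  (colon_jumpSub.2.2 J fun j => by cases j <;> rfl).symm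

end Raw
end CCV

namespace CCV

open Relation

theorem Tgt.Exch.ren {P P' : Tgt .jump} {K : Tgt .cont} (h : Tgt.Exch P P' K) (ρ κ : ℕ → ℕ) :
    Tgt.Exch (P.ren ρ κ) (P'.ren ρ (lift κ)) (K.ren ρ κ) := by
  have := h.sub (fun n => .var (ρ n)) fun n => .kvar (κ n)
  rw [← Tgt.ren_eq_sub, ← Tgt.ren_eq_sub] at this
  convert this using 1
  rw [Tgt.ren_eq_sub]
  congr 1
  funext n; cases n <;> rfl

namespace Raw

open Tgt (XStep Exch TailOf)

/-! ### Simulation of the source calculus -/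

theorem star_wkK (V : Raw .value) : star V.wkK = (star V).wkK := star_ren ..

theorem colon_letT (L M : Raw .term) (K : Tgt .cont) :
    colon (letT L M) K = colon M (.lamC (colon L K.wkV)) := by rw [colon]

theorem colon_xstep (M : Raw .term) :
    ∀ {K K' : Tgt .cont}, XStep K K' → XStep (colon M K) (colon M K') := by
  have wk : ∀ {s : TSort} {P P' : Tgt s}, XStep P P' → XStep P.wkV P'.wkV :=
    fun h => h.ren _ _
  induction M using colon_induction with
  | val V => intro K K' h; simp only [colon]; exact .kappL h
  | app_vv V W => intro K K' h; simp only [colon]; exact .tappR h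
  | app_vn V N hN ih =>
    intro K K' h
    simp only [colon_app_val_left _ hN]
    exact ih (.lamC (.tappR (wk h)))
  | app_nv N V hN ih =>
    intro K K' h
    simp only [colon_app_val_right hN]
    exact ih (.lamC (.tappR (wk h)))
  | app_nn N₁ N₂ h₁ h₂ ih₁ ih₂ =>
    intro K K' h
    simp only [colon_app_nonval h₁ h₂]
    exact ih₁ (.lamC (ih₂ (.lamC (.tappR (wk (wk h))))))
  | letT L M ihL ihM => intro K K' h; simp only [colon]; exact ihM (.lamC (ihL (wk h)))
  | mu J => intro K K' h; simp only [colon]; exact .tappR h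

theorem tailOf_colon (M : Raw .term) : ∀ K : Tgt .cont, TailOf K (colon M K) := by
  induction M using colon_induction with
  | val V => intro K; simp only [colon]; exact .kapp _ _
  | app_vv V W => intro K; simp only [colon]; exact .tapp _ _
  | app_vn V N hN ih =>
    intro K
    rw [colon_app_val_left _ hN]
    exact (ih _).trans rfl (.tapp _ _)
  | app_nv N V hN ih =>
    intro K
    rw [colon_app_val_right hN]
    exact (ih _).trans rfl (.tapp _ _)
  | app_nn N₁ N₂ h₁ h₂ ih₁ ih₂ =>
    intro K
    rw [colon_app_nonval h₁ h₂]
    exact (ih₁ _).trans rfl ((ih₂ _).trans rfl (.tapp _ _))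
  | letT L M ihL ihM => intro K; rw [colon]; exact (ihM _).trans rfl (ihL _)
  | mu J => intro K; rw [colon]; exact .tapp _ _

/-- A redex in tail position of the continuation can be moved in front of the translated term.
The first part, which leaves the result open, is needed for the induction. -/
theorem colon_exch (M : Raw .term) : ∀ {P P' : Tgt .jump} {K : Tgt .cont}, Exch P P' K.wkV →
    Exch (colon M (.lamC P)) (colon M.wkK (.lamC P')) K ∧
      XStep (colon M (.lamC P)) (.tapp (.lamK (colon M.wkK (.lamC P'))) K) := by
  have wk : ∀ {P P' : Tgt .jump} {K : Tgt .cont}, Exch P P' K.wkV →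
      Exch (P.ren (lift Nat.succ) id) (P'.ren (lift Nat.succ) id) K.wkV.wkV := fun h => by
    have := h.ren (lift Nat.succ) id
    rwa [Tgt.wkV_wkV, lift_id] at this
  have wkK_val : ∀ {N : Raw .term}, ¬ N.IsVal → ¬ N.wkK.IsVal := fun h => by
    rwa [wkK, isVal_ren]
  induction M using colon_induction with
  | val V =>
    intro P P' K h
    simp only [wkK, ren, colon, star_ren]
    exact ⟨.kapp _ h, .exchC _ h⟩
  | app_vv V W =>
    intro P P' K h
    simp only [wkK, ren, colon, star_ren]
    exact ⟨.tapp (.app _ _) h, .exchT (.app _ _) h⟩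
  | app_vn V N hN ih =>
    intro P P' K h
    change _ ∧ XStep _ (.tapp (.lamK (colon (app (val V.wkK) N.wkK) _)) _)
    change Exch _ (colon (app (val V.wkK) N.wkK) _) _ ∧ _
    rw [colon_app_val_left _ hN, colon_app_val_left _ (wkK_val hN), star_wkK, Tgt.wkK_wkV]
    exact ih (.tapp (.app (star V).wkV (.var 0)) (wk h))
  | app_nv N V hN ih =>
    intro P P' K h
    change _ ∧ XStep _ (.tapp (.lamK (colon (app N.wkK (val V.wkK)) _)) _)
    change Exch _ (colon (app N.wkK (val V.wkK)) _) _ ∧ _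
    rw [colon_app_val_right hN, colon_app_val_right (wkK_val hN), star_wkK, Tgt.wkK_wkV]
    exact ih (.tapp (.app (.var 0) (star V).wkV) (wk h))
  | app_nn N₁ N₂ h₁ h₂ ih₁ ih₂ =>
    intro P P' K h
    change _ ∧ XStep _ (.tapp (.lamK (colon (app N₁.wkK N₂.wkK) _)) _)
    change Exch _ (colon (app N₁.wkK N₂.wkK) _) _ ∧ _
    have e : N₂.wkK.wkV = N₂.wkV.wkK := by simp only [wkK, wkV, ren_ren]; rfl
    rw [colon_app_nonval h₁ h₂, colon_app_nonval (wkK_val h₁) (wkK_val h₂), e]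
    exact ih₁ (ih₂ (.tapp (.app (.var 1) (.var 0)) (wk (wk h)))).1
  | letT L M ihL ihM =>
    intro P P' K h
    have e : (letT L M).wkK = letT L.wkK M.wkK := by simp only [wkK, ren, lift_id]
    rw [e, colon, colon]
    exact ihM (ihL (wk h)).1
  | mu J =>
    intro P P' K h
    have e : (Tgt.lamK (colonJ J)).wkK = .lamK (colonJ (J.ren id (lift Nat.succ))) := by
      simp only [Tgt.wkK, Tgt.ren, colonJ_ren]
    simp only [wkK, ren, colon]
    rw [← e]
    exact ⟨.tapp _ h, .exchT _ h⟩

/-- `1` for a non-value, `0` for a value. -/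
def nonval : Raw .term → ℕ
  | val _ => 0
  | _ => 1

theorem nonval_val (V : Raw .value) : (val V).nonval = 0 := rfl

theorem nonval_of_not {M : Raw .term} (h : ¬ M.IsVal) : M.nonval = 1 := by
  cases M <;> first | rfl | exact (h ⟨_, rfl⟩).elim

theorem nonval_congr {M M' : Raw .term} (h : M.IsVal ↔ M'.IsVal) : M.nonval = M'.nonval := by
  by_cases hM : M.IsVal
  · obtain ⟨V', rfl⟩ := h.1 hM
    obtain ⟨V, rfl⟩ := hM
    rfl
  · rw [nonval_of_not hM, nonval_of_not (mt h.2 hM)]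

/-- The number of operators and operands that are not values. The rules naming such an
operator or operand, which the colon translation does not see, make it smaller. -/
def adCount : {s : Srt} → Raw s → ℕ
  | _, var _ => 0
  | _, lam M => M.adCount
  | _, val V => V.adCount
  | _, app M N => M.adCount + N.adCount + M.nonval + N.nonval
  | _, letT L M => L.adCount + M.adCount
  | _, mu J => J.adCount
  | _, jmp _ M => M.adCount
  | _, letJ J M => J.adCount + M.adCount

theorem adCount_ren {s : Srt} (M : Raw s) : ∀ ρ κ : ℕ → ℕ, (M.ren ρ κ).adCount = M.adCount := by
  induction M with
  | app M N ih₁ ih₂ =>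
    intro ρ κ
    simp only [ren, adCount, ih₁, ih₂, nonval_congr (isVal_ren M ρ κ),
      nonval_congr (isVal_ren N ρ κ)]
  | _ => intros; simp_all [ren, adCount]

theorem Eqv.isVal_iff {M M' : Raw .term} (h : Eqv M M') : M.IsVal ↔ M'.IsVal := by
  have := (h.inv id id).1
  rwa [ren_id, ren_id] at this

theorem Eqv.adCount_eq {s : Srt} {M M' : Raw s} (h : Eqv M M') : M.adCount = M'.adCount := by
  induction h with
  | assoc L M N => simp only [adCount, wkV', adCount_ren]; omega
  | app h₁ h₂ ih₁ ih₂ =>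
    simp only [adCount, ih₁, ih₂, nonval_congr h₁.isVal_iff, nonval_congr h₂.isVal_iff]
  | _ => simp_all [adCount]

/-- The translation of the first expression reduces, in at least one step, to that of the
second, and values reduce to values. -/
def Red : (s : Srt) → Raw s → Raw s → Prop
  | .value, V, V' => TransGen XStep (star V) (star V')
  | .term, M, M' => (∀ K, TransGen XStep (colon M K) (colon M' K)) ∧
      ∀ V, M = val V → ∃ V', M' = val V' ∧ TransGen XStep (star V) (star V')
  | .jump, J, J' => TransGen XStep (colonJ J) (colonJ J')

theorem Red.of_colon {M M' : Raw .term} (h : ∀ K, TransGen XStep (colon M K) (colon M' K))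
    (hM : ¬ M.IsVal) : Red .term M M' :=
  ⟨h, fun V e => (hM ⟨V, e⟩).elim⟩

theorem not_isVal_app (M N : Raw .term) : ¬ (app M N).IsVal := fun ⟨_, h⟩ => nomatch h

theorem not_isVal_letT (L M : Raw .term) : ¬ (letT L M).IsVal := fun ⟨_, h⟩ => nomatch h

theorem not_isVal_mu (J : Raw .jump) : ¬ (mu J).IsVal := fun ⟨_, h⟩ => nomatch h

/-- The continuation against which a non-value operator is translated; a value takes the
operator position by one more step. -/
theorem exists_cont_left (N : Raw .term) (K : Tgt .cont) : ∃ C : Tgt .cont,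
    (∀ M : Raw .term, ¬ M.IsVal → colon (app M N) K = colon M C) ∧
      ∀ V, XStep (.kapp C (star V)) (colon (app (val V) N) K) := by
  by_cases hN : N.IsVal
  · obtain ⟨W, rfl⟩ := hN
    refine ⟨_, fun M hM => colon_app_val_right hM W K, fun V => ?_⟩
    have := XStep.betaC (.tapp (.app (.var 0) (star W).wkV) K.wkV) (star V)
    change XStep _ (.tapp (.app (star V) ((star W).wkV.instV _)) (K.wkV.instV _)) at this
    rw [Tgt.wkV_instV, Tgt.wkV_instV] at this
    rwa [colon]
  · refine ⟨_, fun M hM => colon_app_nonval hM hN K, fun V => ?_⟩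
    have := XStep.betaC (colon N.wkV (.lamC (.tapp (.app (.var 1) (.var 0)) K.wkV.wkV))) (star V)
    rw [colon_wkV_instV] at this
    have e : (Tgt.lamC (.tapp (.app (.var 1) (.var 0)) K.wkV.wkV)).instV (star V) =
        .lamC (.tapp (.app (star V).wkV (.var 0)) K.wkV) := by
      have := Tgt.wkV_sub_up K.wkV (scons (star V) .var) .kvar
      exact congrArg (fun K : Tgt .cont => Tgt.lamC (.tapp (.app (star V).wkV (.var 0)) K))
        (this.trans (congrArg Tgt.wkV (Tgt.wkV_instV K _)))
    rwa [e, ← colon_app_val_left _ hN] at this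

/-- The continuation against which a non-value operand is translated, the operator being a
value; a value takes the operand position by one more step. -/
theorem exists_cont_right (V : Raw .value) (K : Tgt .cont) : ∃ C : Tgt .cont,
    (∀ N : Raw .term, ¬ N.IsVal → colon (app (val V) N) K = colon N C) ∧
      ∀ W, XStep (.kapp C (star W)) (colon (app (val V) (val W)) K) := by
  refine ⟨_, fun N hN => colon_app_val_left V hN K, fun W => ?_⟩
  have := XStep.betaC (.tapp (.app (star V).wkV (.var 0)) K.wkV) (star W)
  change XStep _ (.tapp (.app ((star V).wkV.instV _) (star W)) (K.wkV.instV _)) at this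
  rw [Tgt.wkV_instV, Tgt.wkV_instV] at this
  rwa [colon]

theorem Red.lam {M M' : Raw .term} (h : Red .term M.wkK M'.wkK) :
    Red .value (lam M) (lam M') := by
  simp only [Red, star]
  exact (h.1 _).lift (fun Q => Tgt.lamV (.lamK Q)) fun _ _ h => .lamV (.lamK h)

theorem Red.val {V V' : Raw .value} (h : Red .value V V') : Red .term (val V) (val V') := by
  refine ⟨fun K => ?_, fun _ e => ⟨V', rfl, by cases e; exact h⟩⟩
  simp only [colon]
  have h : TransGen XStep (star V) (star V') := h
  exact h.lift (Tgt.kapp K) fun _ _ h => .kappR h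

theorem Red.appL {M M' : Raw .term} (h : Red .term M M') (N : Raw .term) :
    Red .term (app M N) (app M' N) := by
  refine .of_colon (fun K => ?_) (not_isVal_app _ _)
  by_cases hM : M.IsVal
  · obtain ⟨V, rfl⟩ := hM
    obtain ⟨V', rfl, hV⟩ := h.2 V rfl
    by_cases hN : N.IsVal
    · obtain ⟨W, rfl⟩ := hN
      simp only [colon]
      exact hV.lift (fun V => Tgt.tapp (.app V _) K) fun _ _ h => .tappL (.appL h)
    · rw [colon_app_val_left _ hN, colon_app_val_left _ hN]
      exact hV.lift (fun V => colon N (.lamC (.tapp (.app V.wkV _) _))) fun _ _ h =>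
        colon_xstep N (.lamC (.tappL (.appL (h.ren _ _))))
  · obtain ⟨C, h₁, h₂⟩ := exists_cont_left N K
    rw [h₁ M hM]
    by_cases hM' : M'.IsVal
    · obtain ⟨V, rfl⟩ := hM'
      have := h.1 C
      rw [colon] at this
      exact this.tail (h₂ V)
    · rw [h₁ M' hM']; exact h.1 C

theorem Red.appR {N N' : Raw .term} (M : Raw .term) (h : Red .term N N')
    (hw : Red .term N.wkV N'.wkV) : Red .term (app M N) (app M N') := by
  refine .of_colon (fun K => ?_) (not_isVal_app _ _)
  by_cases hM : M.IsVal
  · obtain ⟨V, rfl⟩ := hM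
    by_cases hN : N.IsVal
    · obtain ⟨W, rfl⟩ := hN
      obtain ⟨W', rfl, hW⟩ := h.2 W rfl
      simp only [colon]
      exact hW.lift (fun W => Tgt.tapp (.app _ W) K) fun _ _ h => .tappL (.appR h)
    · obtain ⟨C, h₁, h₂⟩ := exists_cont_right V K
      rw [h₁ N hN]
      by_cases hN' : N'.IsVal
      · obtain ⟨W, rfl⟩ := hN'
        have := h.1 C
        rw [colon] at this
        exact this.tail (h₂ W)
      · rw [h₁ N' hN']; exact h.1 C
  · by_cases hN : N.IsVal
    · obtain ⟨W, rfl⟩ := hN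
      obtain ⟨W', rfl, hW⟩ := h.2 W rfl
      rw [colon_app_val_right hM, colon_app_val_right hM]
      exact hW.lift (fun W => colon M (.lamC (.tapp (.app _ W.wkV) _))) fun _ _ h =>
        colon_xstep M (.lamC (.tappL (.appR (h.ren _ _))))
    · rw [colon_app_nonval hM hN]
      have lift : ∀ {Q Q'}, TransGen XStep Q Q' →
          TransGen XStep (colon M (.lamC Q)) (colon M (.lamC Q')) := fun h =>
        h.lift (fun Q => colon M (.lamC Q)) fun _ _ h => colon_xstep M (.lamC h)
      by_cases hN' : N'.IsVal
      · obtain ⟨W, rfl⟩ := hN'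
        rw [colon_app_val_right hM]
        refine lift (((hw.1 _).tail ?_))
        change XStep (colon (.val W.wkV) _) _
        rw [colon, star_wkV]
        have := XStep.betaC (.tapp (.app (.var 1) (.var 0)) K.wkV.wkV) (star W).wkV
        change XStep _ (.tapp (.app (.var 0) (star W).wkV) (K.wkV.wkV.instV _)) at this
        rwa [Tgt.wkV_instV] at this
      · rw [colon_app_nonval hM hN']
        exact lift (hw.1 _)

theorem Red.letTL {L L' : Raw .term} (h : Red .term L L') (M : Raw .term) :
    Red .term (letT L M) (letT L' M) := by
  refine .of_colon (fun K => ?_) (not_isVal_letT _ _)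
  simp only [colon]
  exact (h.1 _).lift (fun Q => colon M (.lamC Q)) fun _ _ h => colon_xstep M (.lamC h)

theorem Red.letTR (L : Raw .term) {M M' : Raw .term} (h : Red .term M M') :
    Red .term (letT L M) (letT L M') := by
  refine .of_colon (fun K => ?_) (not_isVal_letT _ _)
  simp only [colon]
  exact h.1 _

theorem Red.mu {J J' : Raw .jump} (h : Red .jump J J') : Red .term (mu J) (mu J') := by
  refine .of_colon (fun K => ?_) (not_isVal_mu _)
  simp only [colon]
  have h : TransGen XStep (colonJ J) (colonJ J') := h
  exact h.lift (fun Q => Tgt.tapp (.lamK Q) K) fun _ _ h => .tappL (.lamK h)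

theorem Red.jmp (k : ℕ) {M M' : Raw .term} (h : Red .term M M') :
    Red .jump (jmp k M) (jmp k M') := by
  simp only [Red, colonJ]
  exact h.1 _

theorem Red.letJL {J J' : Raw .jump} (h : Red .jump J J') (M : Raw .term) :
    Red .jump (letJ J M) (letJ J' M) := by
  simp only [Red, colonJ]
  have h : TransGen XStep (colonJ J) (colonJ J') := h
  exact h.lift (fun Q => colon M (.lamC Q)) fun _ _ h => colon_xstep M (.lamC h)

theorem Red.letJR (J : Raw .jump) {M M' : Raw .term} (h : Red .term M M') :
    Red .jump (letJ J M) (letJ J M') := by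
  simp only [Red, colonJ]
  exact h.1 _

theorem colonJ_instK (J : Raw .jump) (l : ℕ) :
    colonJ (J.instK l) = (colonJ J).instK (.kvar l) := by
  rw [instK, colonJ_ren, Tgt.ren_eq_sub, Tgt.instK]
  congr 1
  funext n; cases n <;> rfl

theorem red_betaLam (M : Raw .term) (V : Raw .value) :
    Red .term (app (.val (.lam M)) (.val V)) (letT M (.val V)) := by
  refine .of_colon (fun K => .single ?_) (not_isVal_app _ _)
  simp only [colon, star]
  have := XStep.betaApp (colon M.wkK (.kvar 0)) (star V) K
  rwa [colon_wkK_instK] at this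

theorem red_betaLet (M : Raw .term) (V : Raw .value) :
    Red .term (letT M (.val V)) (M.inst V) := by
  refine .of_colon (fun K => .single ?_) (not_isVal_letT _ _)
  simp only [colon]
  have := XStep.betaC (colon M K.wkV) (star V)
  rwa [colon_instV, Tgt.wkV_instV] at this

theorem red_betaMu (M : Raw .term) (J : Raw .jump) :
    Red .term (letT M (.mu J)) (.mu (J.jumpSub 0 M.wkK)) := by
  refine .of_colon (fun K => .single ?_) (not_isVal_letT _ _)
  simp only [colon]
  have := XStep.betaMu (colonJ J) (colon M.wkK (.kvar 0)) K (tailOf_colon _ _)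
  rwa [colon_wkK_instK, ← colonJ_jumpSub] at this

theorem red_betaJmp (l : ℕ) (J : Raw .jump) : Red .jump (.jmp l (.mu J)) (J.instK l) := by
  simp only [Red, colonJ, colon, colonJ_instK]
  exact .single (.betaK _ _)

theorem red_etaLam (V : Raw .value) :
    Red .value (.lam (app (.val V.wkV) (.val (var 0)))) V := by
  have h₁ := XStep.etaK (.app (star V).wkV (.var 0))
  have h₂ := XStep.etaV (star V)
  have e : star (.lam (app (.val V.wkV) (.val (var 0)))) =
      .lamV (.lamK (.tapp (Tgt.app (star V).wkV (.var 0)).wkK (.kvar 0))) := by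
    rw [star]
    simp only [wkK, ren, colon, star_ren, wkV, star]
    rfl
  rw [Red, e]
  exact .tail (.single (.lamV h₁)) h₂

theorem red_etaLet (M : Raw .term) : Red .term (letT (.val (var 0)) M) M := by
  refine .of_colon (fun K => .single ?_) (not_isVal_letT _ _)
  simp only [colon, star]
  exact colon_xstep M (.etaC K)

theorem red_etaMu (M : Raw .term) : Red .term (.mu (.jmp 0 M.wkK)) M := by
  refine .of_colon (fun K => .single ?_) (not_isVal_mu _)
  simp only [colon, colonJ]
  have := XStep.betaK (colon M.wkK (.kvar 0)) K
  rwa [colon_wkK_instK] at this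

theorem red_exch (J : Raw .jump) (M : Raw .term) :
    Red .term (letT (.mu J) M) (.mu (letJ J M.wkK)) := by
  refine .of_colon (fun K => .single ?_) (not_isVal_letT _ _)
  simp only [colon, colonJ]
  exact (colon_exch M (.here _ _)).2

theorem inv_ad₁ {N : Raw .term} (hN : ¬ N.IsVal) (M : Raw .term) :
    Inv .term (app N M) (letT (app (.val (var 0)) M.wkV) N) := by
  refine ⟨by simp [IsVal], fun K => ?_⟩
  rw [colon_letT]
  by_cases hM : M.IsVal
  · obtain ⟨V, rfl⟩ := hM
    rw [colon_app_val_right hN]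
    simp only [wkV, ren, colon, star, star_ren]
    rfl
  · rw [colon_app_nonval hN hM, colon_app_val_left _ (by rwa [wkV, isVal_ren]), star]
    rfl

theorem inv_ad₂ (V : Raw .value) {N : Raw .term} (hN : ¬ N.IsVal) :
    Inv .term (app (.val V) N) (letT (app (.val V.wkV) (.val (var 0))) N) := by
  refine ⟨by simp [IsVal], fun K => ?_⟩
  rw [colon_app_val_left _ hN]
  simp only [colon, star, star_wkV]

theorem Inv.lam {M M' : Raw .term} (h : Inv .term M.wkK M'.wkK) :
    Inv .value (lam M) (lam M') := by
  simp only [Inv, star, h.2]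

theorem Inv.val {V V' : Raw .value} (h : Inv .value V V') : Inv .term (val V) (val V') :=
  ⟨by simp [IsVal], fun K => by
    have h : star V = star V' := h
    simp only [colon, h]⟩

theorem Inv.letT {L L' M M' : Raw .term} (hL : Inv .term L L') (hM : Inv .term M M') :
    Inv .term (letT L M) (letT L' M') :=
  ⟨by simp [IsVal], fun K => by simp only [colon, hL.2, hM.2]⟩

theorem Inv.mu {J J' : Raw .jump} (h : Inv .jump J J') : Inv .term (mu J) (mu J') :=
  ⟨by simp [IsVal], fun K => by
    have h : colonJ J = colonJ J' := h
    simp only [colon, h]⟩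

theorem Inv.jmp (k : ℕ) {M M' : Raw .term} (h : Inv .term M M') :
    Inv .jump (jmp k M) (jmp k M') := by
  simp only [Inv, colonJ, h.2]

theorem Inv.letJ {J J' : Raw .jump} {M M' : Raw .term} (hJ : Inv .jump J J')
    (hM : Inv .term M M') : Inv .jump (letJ J M) (letJ J' M') := by
  have hJ : colonJ J = colonJ J' := hJ
  simp only [Inv, colonJ, hJ, hM.2]

theorem Inv.refl {s : Srt} (M : Raw s) : Inv s M M := by
  cases s <;> simp [Inv]

/-- A source step is either seen by the translation, as at least one step, or it names a
non-value, leaves the translation unchanged, and decreases `adCount`. -/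
theorem Step.red_or_inv {s : Srt} {M M' : Raw s} (h : Step M M') :
    (∀ ρ κ : ℕ → ℕ, Red s (M.ren ρ κ) (M'.ren ρ κ)) ∨
      (∀ ρ κ : ℕ → ℕ, Inv s (M.ren ρ κ) (M'.ren ρ κ)) ∧ M'.adCount < M.adCount := by
  induction h with
  | ad₁ N M hN =>
    refine .inr ⟨fun ρ κ => ?_, ?_⟩
    · have := inv_ad₁ (N := N.ren ρ κ) (by rwa [isVal_ren]) (M.ren ρ κ)
      rwa [← wkV_ren] at this
    · simp only [adCount, wkV, adCount_ren, nonval_of_not hN, nonval_congr (isVal_ren M _ _),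
        nonval_val]
      omega
  | ad₂ V N hN =>
    refine .inr ⟨fun ρ κ => ?_, ?_⟩
    · have := inv_ad₂ (V.ren ρ κ) (N := N.ren ρ κ) (by rwa [isVal_ren])
      rwa [← wkV_ren] at this
    · simp only [adCount, wkV, adCount_ren, nonval_of_not hN, nonval_val]
      omega
  | betaLam M V => exact .inl fun ρ κ => red_betaLam _ _
  | betaLet M V => exact .inl fun ρ κ => by rw [inst_ren]; exact red_betaLet _ _
  | betaMu M J =>
    refine .inl fun ρ κ => ?_
    have h := jumpSub_ren J 0 M.wkK ρ (lift κ) fun j hj => by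
      cases j
      · rfl
      · cases hj
    rw [wkK_ren] at h
    have := red_betaMu (M.ren (lift ρ) κ) (J.ren ρ (lift κ))
    rw [ren, ren, ren, h]
    exact this
  | betaJmp l J => exact .inl fun ρ κ => by rw [instK_ren]; exact red_betaJmp _ _
  | etaLam V =>
    refine .inl fun ρ κ => ?_
    have := red_etaLam (V.ren ρ κ)
    rwa [← wkV_ren] at this
  | etaLet M => exact .inl fun ρ κ => red_etaLet _
  | etaMu M =>
    refine .inl fun ρ κ => ?_
    have := red_etaMu (M.ren ρ κ)
    rwa [← wkK_ren] at this
  | exch J M =>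
    refine .inl fun ρ κ => ?_
    have := red_exch (J.ren (lift ρ) (lift κ)) (M.ren ρ κ)
    rwa [← wkK_ren] at this
  | lam _ ih =>
    refine ih.imp (fun ih ρ κ => .lam ?_) fun ih => ⟨fun ρ κ => .lam ?_, ih.2⟩ <;>
      simp only [wkK, ren_ren]
    exacts [ih _ _, ih.1 _ _]
  | val _ ih =>
    exact ih.imp (fun ih ρ κ => (ih _ _).val) fun ih => ⟨fun ρ κ => (ih.1 _ _).val, ih.2⟩
  | @appL M M' N _ ih =>
    refine ih.imp (fun ih ρ κ => (ih _ _).appL _) fun ih => ⟨fun ρ κ => ?_, ?_⟩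
    · refine (ih.1 _ _).app (.refl _) ?_ (.refl _)
      simp only [wkV, ren_ren]
      exact ih.1 _ _
    · have := ih.1 id id
      rw [ren_id, ren_id] at this
      have := nonval_congr this.1
      simp only [adCount]
      omega
  | @appR M N N' _ ih =>
    refine ih.imp (fun ih ρ κ => .appR _ (ih _ _) ?_) fun ih => ⟨fun ρ κ => ?_, ?_⟩
    · simp only [wkV, ren_ren]
      exact ih _ _
    · refine Inv.app (.refl _) (ih.1 _ _) (.refl _) ?_
      simp only [wkV, ren_ren]
      exact ih.1 _ _
    · have := ih.1 id id
      rw [ren_id, ren_id] at this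
      have := nonval_congr this.1
      simp only [adCount]
      omega
  | letTL _ ih =>
    exact ih.imp (fun ih ρ κ => (ih _ _).letTL _) fun ih =>
      ⟨fun ρ κ => (ih.1 _ _).letT (.refl _), by have := ih.2; simp only [adCount]; omega⟩
  | letTR _ ih =>
    exact ih.imp (fun ih ρ κ => (ih _ _).letTR _) fun ih =>
      ⟨fun ρ κ => Inv.letT (.refl _) (ih.1 _ _), by have := ih.2; simp only [adCount]; omega⟩
  | mu _ ih =>
    exact ih.imp (fun ih ρ κ => (ih _ _).mu) fun ih => ⟨fun ρ κ => (ih.1 _ _).mu, ih.2⟩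
  | jmp _ ih =>
    exact ih.imp (fun ih ρ κ => (ih _ _).jmp _) fun ih => ⟨fun ρ κ => (ih.1 _ _).jmp _, ih.2⟩
  | letJL _ ih =>
    exact ih.imp (fun ih ρ κ => (ih _ _).letJL _) fun ih =>
      ⟨fun ρ κ => (ih.1 _ _).letJ (.refl _), by have := ih.2; simp only [adCount]; omega⟩
  | letJR _ ih =>
    exact ih.imp (fun ih ρ κ => (ih _ _).letJR _) fun ih =>
      ⟨fun ρ κ => Inv.letJ (.refl _) (ih.1 _ _), by have := ih.2; simp only [adCount]; omega⟩

theorem Step.cps {M M' : Raw .term} (h : Step M M') :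
    TransGen XStep M.cps M'.cps ∨ M.cps = M'.cps ∧ M'.adCount < M.adCount :=
  h.red_or_inv.imp
    (fun h => ((h id Nat.succ).1 _).lift Tgt.lamK fun _ _ h => .lamK h)
    fun h => ⟨congrArg Tgt.lamK ((h.1 id Nat.succ).2 _), h.2⟩

/-- Induction on the translation for `XStep`, and then on `adCount`. -/
theorem sn_of_xsn_cps {P : Tgt .term} (hP : Tgt.XSN P) : ∀ M : Raw .term,
    ReflTransGen XStep P M.cps →
      StronglyNormalizable Term.Step (Quotient.mk (Raw.setoid .term) M) := by
  induction hP with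
  | intro P _ ih =>
    have plus : ∀ M : Raw .term, TransGen XStep P M.cps →
        StronglyNormalizable Term.Step (Quotient.mk (Raw.setoid .term) M) := fun M h => by
      obtain ⟨P', h₁, h₂⟩ := TransGen.head'_iff.1 h
      exact ih P' h₁ M h₂
    intro M hM
    rcases reflTransGen_iff_eq_or_transGen.1 hM with e | h
    · clear hM
      induction hn : M.adCount using Nat.strong_induction_on generalizing M with
      | _ n ihn =>
        refine Acc.intro _ fun Y hY => ?_
        obtain ⟨A, B, hA, rfl, hAB⟩ := hY
        have hA : Eqv A M := Quotient.exact hA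
        have e : A.cps = P := hA.cps_eq.trans e
        rcases hAB.cps with h | ⟨h, hlt⟩
        · exact plus B (e ▸ h)
        · exact ihn B.adCount (by rw [← hn, ← hA.adCount_eq]; exact hlt) B (h.symm.trans e) rfl
    · exact plus M h

end Raw
end CCV

namespace CCV
namespace Raw

open Relation
open Tgt (HeadSN)

/-! ### Head reductions of the source calculus -/

/-- Reduction modulo the syntactic equality. -/
def StepE {s : Srt} (M N : Raw s) : Prop := ∃ P Q, Eqv M P ∧ Step P Q ∧ Eqv Q N

theorem Step.stepE {s : Srt} {M N : Raw s} (h : Step M N) : StepE M N :=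
  ⟨M, N, .refl _, h, .refl _⟩

theorem StepE.map {s t : Srt} (f : Raw s → Raw t) (h₁ : ∀ {M N}, Eqv M N → Eqv (f M) (f N))
    (h₂ : ∀ {M N}, Step M N → Step (f M) (f N)) {M N : Raw s} (h : StepE M N) :
    StepE (f M) (f N) := by
  obtain ⟨P, Q, hP, hPQ, hQ⟩ := h
  exact ⟨f P, f Q, h₁ hP, h₂ hPQ, h₁ hQ⟩

/-- `Subterm X M`: the expression `M` occurs in `X`, up to the syntactic equality. Since every jump
equals some `[k] M`, the parts of a let in a jump need no clause of their own. -/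
inductive Subterm {t : Srt} (X : Raw t) : {s : Srt} → Raw s → Prop
  | refl : Subterm X X
  | eqv {s : Srt} {M M' : Raw s} : Subterm X M → Eqv M M' → Subterm X M'
  | lam {M : Raw .term} : Subterm X (lam M) → Subterm X M
  | val {V : Raw .value} : Subterm X (val V) → Subterm X V
  | appL {M N : Raw .term} : Subterm X (app M N) → Subterm X M
  | appR {M N : Raw .term} : Subterm X (app M N) → Subterm X N
  | letTL {L M : Raw .term} : Subterm X (letT L M) → Subterm X L
  | letTR {L M : Raw .term} : Subterm X (letT L M) → Subterm X M
  | mu {J : Raw .jump} : Subterm X (mu J) → Subterm X J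
  | jmp {k : ℕ} {M : Raw .term} : Subterm X (jmp k M) → Subterm X M

theorem Subterm.lift_step {t s : Srt} {X : Raw t} {M : Raw s} (h : Subterm X M) :
    ∀ {M'}, StepE M M' → ∃ X', StepE X X' ∧ Subterm X' M' := by
  induction h with
  | refl => exact fun h => ⟨_, h, .refl⟩
  | eqv _ e ih =>
    rintro M' ⟨P, Q, hP, hPQ, hQ⟩
    exact ih ⟨P, Q, e.trans hP, hPQ, hQ⟩
  | lam _ ih =>
    intro _ h
    obtain ⟨X', h₁, h₂⟩ := ih (h.map Raw.lam .lam .lam)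
    exact ⟨X', h₁, .lam h₂⟩
  | val _ ih =>
    intro _ h
    obtain ⟨X', h₁, h₂⟩ := ih (h.map Raw.val .val .val)
    exact ⟨X', h₁, .val h₂⟩
  | @appL M N _ ih =>
    intro _ h
    obtain ⟨X', h₁, h₂⟩ := ih (h.map (Raw.app · N) (.app · (.refl _)) .appL)
    exact ⟨X', h₁, .appL h₂⟩
  | @appR M N _ ih =>
    intro _ h
    obtain ⟨X', h₁, h₂⟩ := ih (h.map (Raw.app M) (.app (.refl _)) .appR)
    exact ⟨X', h₁, .appR h₂⟩
  | @letTL L M _ ih =>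
    intro _ h
    obtain ⟨X', h₁, h₂⟩ := ih (h.map (Raw.letT · M) (.letT · (.refl _)) .letTL)
    exact ⟨X', h₁, .letTL h₂⟩
  | @letTR L M _ ih =>
    intro _ h
    obtain ⟨X', h₁, h₂⟩ := ih (h.map (Raw.letT L) (.letT (.refl _)) .letTR)
    exact ⟨X', h₁, .letTR h₂⟩
  | mu _ ih =>
    intro _ h
    obtain ⟨X', h₁, h₂⟩ := ih (h.map Raw.mu .mu .mu)
    exact ⟨X', h₁, .mu h₂⟩
  | @jmp k M _ ih =>
    intro _ h
    obtain ⟨X', h₁, h₂⟩ := ih (h.map (Raw.jmp k) .jmp .jmp)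
    exact ⟨X', h₁, .jmp h₂⟩

theorem Eqv.size_eq {s : Srt} {M M' : Raw s} (h : Eqv M M') : M.size = M'.size := by
  induction h with
  | assoc L M N => simp only [size, wkV', size_ren]; omega
  | jmpLet k L M => simp only [size]; omega
  | _ => simp_all [size]

theorem exists_eqv_jmp : ∀ J : Raw .jump, ∃ k M, Eqv J (jmp k M)
  | jmp k M => ⟨k, M, .refl _⟩
  | letJ J N => by
    obtain ⟨k, M, h⟩ := exists_eqv_jmp J
    exact ⟨k, letT M N, (Eqv.letJ h (.refl _)).trans (Eqv.jmpLet k M N).symm⟩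

/-- The term `N`, or `let x = N in L`. -/
def plug : Option (Raw .term) → Raw .term → Raw .term
  | none, N => N
  | some L, N => letT L N

/-- The continuation of `N` in the translation of `plug c N` with a fresh continuation variable. -/
def plugCont : Option (Raw .term) → Tgt .cont
  | none => .kvar 0
  | some L => .lamC (colon L.wkK (.kvar 0))

/-- By associativity, nested lets in the argument position of a let can be brought outside. -/
theorem exists_eqv_plug : ∀ M : Raw .term,
    ∃ c N, Eqv M (plug c N) ∧ ∀ L P, N ≠ letT L P
  | letT L M => by
    obtain ⟨c, N, h, hN⟩ := exists_eqv_plug M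
    cases c with
    | none => exact ⟨some L, N, .letT (.refl _) h, hN⟩
    | some P =>
      exact ⟨some (letT L.wkV' P), N, (Eqv.letT (.refl _) h).trans (.assoc L P N), hN⟩
  | val V => ⟨none, val V, .refl _, nofun⟩
  | app M N => ⟨none, app M N, .refl _, nofun⟩
  | mu J => ⟨none, mu J, .refl _, nofun⟩

theorem colon_plug (c : Option (Raw .term)) (N : Raw .term) :
    colon (plug c N).wkK (.kvar 0) = colon N.wkK (plugCont c) := by
  cases c with
  | none => rfl
  | some L =>
    have e : (letT L N).wkK = letT L.wkK N.wkK := by simp only [wkK, ren, lift_id]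
    rw [plug, e, colon_letT]
    rfl

theorem Step.plug (c : Option (Raw .term)) {N N' : Raw .term} (h : Step N N') :
    Step (plug c N) (plug c N') := by
  cases c with
  | none => exact h
  | some L => exact .letTR h

theorem Subterm.of_plug {t : Srt} {X : Raw t} {c : Option (Raw .term)} {N : Raw .term}
    (h : Subterm X (plug c N)) : Subterm X N := by
  cases c with
  | none => exact h
  | some L => exact .letTR h

theorem size_le_plug (c : Option (Raw .term)) (N : Raw .term) : N.size ≤ (plug c N).size := by
  cases c with
  | none => exact le_rfl
  | some L => simp only [plug, size]; omega

theorem colon_wkK_instK_kvar (M : Raw .term) (K : Tgt .cont) :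
    (colon M.wkK (.kvar 0)).instK K = colon M K := colon_wkK_instK M _ K

/-- Strong normalizability of the translation of a value, of a term with a fresh continuation
variable, and of a jump. -/
def Good : {s : Srt} → Raw s → Prop
  | .value, V => HeadSN (star V)
  | .term, M => HeadSN (colon M.wkK (.kvar 0))
  | .jump, J => HeadSN (colonJ J)

theorem Good.congr {M M' : Raw .term} (h : M.Good) (e : Eqv M' M) : M'.Good := by
  have := (e.inv id Nat.succ).2 (.kvar 0)
  rw [Good, wkK, this]
  exact h

theorem Good.star_wkK {V : Raw .value} (h : V.Good) : HeadSN (star V.wkK) := by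
  rw [Raw.star_wkK]; exact HeadSN.ren h _ _

theorem Good.colon_kvar {M : Raw .term} (h : M.Good) (k : ℕ) : HeadSN (colon M (.kvar k)) := by
  have := HeadSN.ren h id (scons k id)
  rwa [← colon_ren, wkK, ren_ren, show scons k id ∘ Nat.succ = id from rfl,
    show id ∘ id = (id : ℕ → ℕ) from rfl, ren_id] at this

theorem colonJ_ren_instK (J : Raw .jump) (K : Tgt .cont) :
    (colonJ (J.ren id (lift Nat.succ))).instK K = (colonJ J).replK K := by
  rw [colonJ_ren, Tgt.instK, Tgt.ren_sub, Tgt.replK]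
  congr 1
  funext n; cases n <;> rfl

theorem replK_kvar {s : TSort} (Q : Tgt s) : Q.replK (.kvar 0) = Q := by
  conv_rhs => rw [← Tgt.sub_id Q]
  rw [Tgt.replK]
  congr 1
  funext n; cases n <;> rfl

/-- The translation of a strongly normalizable expression is strongly normalizable: every head
reduct of the translation comes from a reduct, or from a smaller part, of the expression. -/
theorem good_of_subterm {t : Srt} {X : Raw t} (hX : StronglyNormalizable StepE X) :
    ∀ {s : Srt} (M : Raw s), Subterm X M → M.Good := by
  induction hX with
  | intro X _ ih =>
    have red : ∀ {s : Srt} {M M' : Raw s}, Subterm X M → Step M M' → M'.Good := fun hM h => by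
      obtain ⟨X', h₁, h₂⟩ := hM.lift_step h.stepE
      exact ih X' h₁ _ h₂
    intro s M
    induction hn : M.size using Nat.strong_induction_on generalizing s M with
    | _ n ihn =>
      intro hM
      cases s with
      | value =>
        cases M with
        | var x => rw [Good, star]; exact .var x
        | lam M =>
          rw [Good, star]
          have : M.Good := ihn M.size (by simp only [size] at hn; omega) M rfl hM.lam
          exact .lamV (.lamK this)
      | jump =>
        obtain ⟨k, N, e⟩ := exists_eqv_jmp M
        have hs := e.size_eq
        simp only [size] at hs
        have : N.Good := ihn N.size (by omega) N rfl (hM.eqv e).jmp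
        have eJ : colonJ M = colonJ (jmp k N) := by
          have := e.inv id id
          rwa [ren_id, ren_id] at this
        rw [Good, eJ, colonJ]
        exact this.colon_kvar k
      | term =>
        obtain ⟨c, N, e, hN⟩ := exists_eqv_plug M
        have hs := e.size_eq
        have hle := size_le_plug c N
        have hM := hM.eqv e
        refine Good.congr ?_ e
        have hc : HeadSN (plugCont c) := by
          cases c with
          | none => exact .kvar 0
          | some L =>
            simp only [plug, size] at hs
            have : L.Good := ihn L.size (by omega) L rfl hM.letTL
            exact .lamC this
        -- a step that the translation does not see
        have silent : ∀ N', Step N N' → (∀ ρ κ, Inv .term (N.ren ρ κ) (N'.ren ρ κ)) →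
            (plug c N).Good := fun N' h hi => by
          have := red hM (h.plug c)
          rw [Good, colon_plug] at this ⊢
          rwa [wkK, (hi id Nat.succ).2]
        cases N with
        | letT L P => exact (hN L P rfl).elim
        | val V =>
          have hV : V.Good := ihn V.size (by simp only [size] at hle; omega) V rfl hM.of_plug.val
          rw [Good, colon_plug]
          simp only [wkK, ren, colon]
          cases c with
          | none => exact .kappVar 0 hV.star_wkK
          | some L =>
            refine .kappLam hV.star_wkK ?_
            have h := red hM (.betaLet L V)
            rw [Good, wkK, inst_ren, lift_id] at h
            change HeadSN ((colon L.wkK (.kvar 0)).instV (star V.wkK))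
            rw [colon_instV]
            exact h
        | mu J =>
          rw [Good, colon_plug]
          simp only [wkK, ren, colon]
          refine .tappLamK hc ?_
          rw [colonJ_ren_instK]
          cases c with
          | none =>
            rw [plugCont, replK_kvar]
            exact ihn J.size (by simp only [size] at hle; omega) J rfl hM.of_plug.mu
          | some L =>
            have h := red hM (.betaMu L J)
            rw [Good] at h
            simp only [wkK, ren, colon] at h
            cases h with
            | tappLamK _ h =>
              rw [colonJ_ren_instK, replK_kvar] at h
              rw [plugCont, ← colonJ_jumpSub]
              exact h
        | app A B =>
          by_cases hA : A.IsVal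
          · obtain ⟨V, rfl⟩ := hA
            by_cases hB : B.IsVal
            · obtain ⟨W, rfl⟩ := hB
              simp only [size] at hle
              have hW : W.Good := ihn W.size (by omega) W rfl hM.of_plug.appR.val
              rw [Good, colon_plug]
              simp only [wkK, ren, colon]
              cases V with
              | var x =>
                simp only [ren, star]
                exact .tappAppVar x hW.star_wkK hc
              | lam P =>
                have h := red hM ((Step.betaLam P W).plug c)
                rw [Good, colon_plug] at h
                simp only [wkK, ren, lift_id, colon] at h
                simp only [ren, lift_id, star]
                cases h with
                | kappLam _ h =>
                  refine .tappAppLam hW.star_wkK ?_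
                  refine .tappLamK hc ?_
                  rw [← colon_wkK_instK_kvar, Tgt.instK_wkV_instV] at h
                  exact h
            · exact silent _ (.ad₂ V B hB) fun ρ κ => by
                have := inv_ad₂ (V.ren ρ κ) (N := B.ren ρ κ) (by rwa [isVal_ren])
                rwa [← wkV_ren] at this
          · exact silent _ (.ad₁ A B hA) fun ρ κ => by
              have := inv_ad₁ (N := A.ren ρ κ) (by rwa [isVal_ren]) (B.ren ρ κ)
              rwa [← wkV_ren] at this

theorem sn_stepE {M : Raw .term}
    (h : StronglyNormalizable Term.Step (Quotient.mk (Raw.setoid .term) M)) :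
    StronglyNormalizable StepE M := by
  generalize e : Quotient.mk (Raw.setoid .term) M = Y at h
  induction h generalizing M with
  | intro Y _ ih =>
    subst e
    refine Acc.intro _ ?_
    rintro N ⟨P, Q, hP, hPQ, hQ⟩
    exact ih _ ⟨P, Q, Quotient.sound hP.symm, Quotient.sound hQ, hPQ⟩ rfl

end Raw
end CCV

/-- A CCV `λμ`-term is strongly normalizable if and only if its CPS translation (defined by the
colon translation) is strongly normalizable for `βη`-reduction in the sorted lambda calculus. -/
theorem mainTheorem2 (M : CCV.Term) :
    StronglyNormalizable CCV.Term.Step M ↔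
      StronglyNormalizable (CCV.Tgt.Step (s := .term)) M.cps := by
  induction M using Quotient.inductionOn with
  | h M =>
    refine ⟨fun h => ?_, fun h => ?_⟩
    · have hM : M.Good := CCV.Raw.good_of_subterm (CCV.Raw.sn_stepE h) M .refl
      exact CCV.Tgt.sn_iff_headSN.2 (.lamK hM)
    · exact CCV.Raw.sn_of_xsn_cps (CCV.Tgt.sn_iff_headSN.1 h).xsn M .refl
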